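/- **Setting.** Let $m\ge 4$ and $n\ge 14$ be even integers, $n=2n'$, and let $k,\ell\in\mathbb{Z}_n$ with $k$ odd and $\ell$ even. The graph $\mathcal{X}_a(m,n,k,\ell)$ has vertices $u_{i,j}$, $i\in\mathbb{Z}_m$, $j\in\mathbb{Z}_n$, and edges of two kinds. The *links* are $u_{i,j}u_{i+1,j}$ for $0\le i\le m-2$ and $j\equiv i\pmod 2$, together with $u_{m-1,j}u_{0,j+\ell}$ for $j$ odd. The *non-links* are $u_{i,j}u_{i,j\pm 1}$ for $i$ even and $u_{i,j}u_{i,j\pm k}$ for $i$ odd, for all $j\in\mathbb{Z}_n$. Equalities between elements of $\mathbb{Z}_n$ and integers are in $\mathbb{Z}_n$, and $x=\pm y$ means $x\in\{y,-y\}$ (similarly for $x=n'\pm y$). Assume that $2k\ne\pm2$ and $2k^2=\pm2$, and that one of the following holds: * $\ell k=\pm\ell$, and at least one of $k^2=\pm1$ and $4\mid m$ holds; or * $\ell k=n'\pm\ell$, $m\equiv2\pmod 4$ and $k^2=n'\pm1$. A $10$-cycle $(v_0,\dots,v_9)$ has *code* $c_0c_1\cdots c_9$, where $c_j=0$ if $v_jv_{j+1}$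 is a link and $c_j=1$ otherwise (indices modulo $10$); codes are considered up to rotation and reflection. It is of *type $2$* if its code is $1^6\,0\,1^2\,0$, and of *type $3$* if its code is $1^3\,0\,1\,0\,1\,0\,1\,0$. For fixed $m$ and $n$, consider the following changes of parameters: $(k,\ell)\mapsto(-k,\ell)$; $(k,\ell)\mapsto(k,-\ell)$; and, if $4\mid n$, $(k,\ell)\mapsto(k+n',\ell)$ when $4\mid m$, and $(k,\ell)\mapsto(k+n',\ell+n')$ when $4\nmid m$. **Proposition.** Let $\Gamma=\mathcal{X}_a(m,n,k,\ell)$ be as above, and suppose in addition that $4k=4$ and that $\Gamma$ has no $10$-cycles of type $2$ or $3$. If some automorphism of $\Gamma$ fixes $u_{0,0}$ and interchanges $u_{1,0}$ with one of $u_{0,1}$ and $u_{0,-1}$, then there exist integers $m_0\ge2$, $n_0\ge1$ and $0\le\ell_0<4n_0$ with $$m=2m_0,\qquad n=4n_0m,\qquad 8n_0\mid(m_0n_0+\ell_0-1)(m_0n_0+\ell_0+3),$$ such that the pair $(n_0m+1,\ \ell_0m)\in\mathbb{Z}_n^2$ is obtained from $(k,\ell)$ by finitely many of the above changes of parameters,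 and $\Gamma\cong\mathcal{X}_a(m,n,n_0m+1,\ell_0m)$. -/

import Mathlib

namespace AltCycle

/-- Vertices `u_{i,j}` with `i ∈ ℤ_m`, `j ∈ ℤ_n`; the pair `(i, j)` stands for `u_{i,j}`. -/
abbrev Vertex (m n : ℕ) : Type := ZMod m × ZMod n

/-- `j ≡ i (mod 2)`, where `i` and `j` are represented by integers in `[0, m)` and `[0, n)`.
For even `n` the parity of `j ∈ ℤ_n` does not depend on the representative. -/
def SameParity {m n : ℕ} (i : ZMod m) (j : ZMod n) : Prop :=
  j.val % 2 = i.val % 2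

/-- Oriented links: `u_{i,j} → u_{i+1,j}` for `0 ≤ i ≤ m-2`, and `u_{m-1,j} → u_{0,j+ℓ}`,
in both cases for `j ≡ i (mod 2)`. -/
def LinkTo {m n : ℕ} (ℓ : ZMod n) (x y : Vertex m n) : Prop :=
  SameParity x.1 x.2 ∧
    ((x.1.val + 1 < m ∧ y = (x.1 + 1, x.2)) ∨ (x.1.val + 1 = m ∧ y = (0, x.2 + ℓ)))

/-- `xy` is a link, that is, an edge joining two different cycles of the `2`-factor. -/
def IsLink {m n : ℕ} (ℓ : ZMod n) (x y : Vertex m n) : Prop :=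
  LinkTo ℓ x y ∨ LinkTo ℓ y x

/-- Oriented non-links: `u_{i,j} → u_{i,j+a_i}` and `u_{i,j} → u_{i,j+b_i}` for
`j ≡ i (mod 2)`. -/
def NonLinkTo {m n : ℕ} (a b : ZMod m → ZMod n) (x y : Vertex m n) : Prop :=
  SameParity x.1 x.2 ∧ (y = (x.1, x.2 + a x.1) ∨ y = (x.1, x.2 + b x.1))

/-- The graph `X_a(m,n,S,ℓ)` with signature `S = [{a_0,b_0}, …, {a_{m-1},b_{m-1}}]`. -/
def XaSignature (m n : ℕ) (a b : ZMod m → ZMod n) (ℓ : ZMod n) : SimpleGraph (Vertex m n) :=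
  SimpleGraph.fromRel fun x y => LinkTo ℓ x y ∨ NonLinkTo a b x y

/-- The entries of `[1, k, 1, k, …, 1, k]`. -/
def altEntry {m n : ℕ} (k : ZMod n) (i : ZMod m) : ZMod n :=
  if i.val % 2 = 0 then 1 else k

/-- The graph `X_a(m,n,k,ℓ)`, with signature `[{1,-1}, {k,-k}, {1,-1}, …, {k,-k}]`. -/
def Xa (m n : ℕ) (k ℓ : ZMod n) : SimpleGraph (Vertex m n) :=
  XaSignature m n (fun i => altEntry k i) (fun i => -altEntry k i) ℓ

/-- The arithmetic conditions on the parameters of `X_a(m,n,k,ℓ)` which single out the graphs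
with a vertex-transitive group of automorphisms preserving the `2`-factor of the `m` cycles of
length `n`. Here `n' = n / 2`, and each `±` is read as "one of the two". -/
structure Admissible (m n : ℕ) (k ℓ : ZMod n) : Prop where
  three_le_m : 3 ≤ m
  even_m : Even m
  four_le_n : 4 ≤ n
  even_n : Even n
  even_ℓ : Even ℓ.val
  odd_k : Odd k.val
  two_k_ne : 2 * k ≠ 2 ∧ 2 * k ≠ -2
  two_k_sq : 2 * k ^ 2 = 2 ∨ 2 * k ^ 2 = -2
  cond :
    ((ℓ * k = ℓ ∨ ℓ * k = -ℓ) ∧ ((k ^ 2 = 1 ∨ k ^ 2 = -1) ∨ 4 ∣ m)) ∨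
    ((ℓ * k = ((n / 2 : ℕ) : ZMod n) + ℓ ∨ ℓ * k = ((n / 2 : ℕ) : ZMod n) - ℓ) ∧
      m % 4 = 2 ∧
      (k ^ 2 = ((n / 2 : ℕ) : ZMod n) + 1 ∨ k ^ 2 = ((n / 2 : ℕ) : ZMod n) - 1))

/-- `X_a(m,n,k,ℓ)` has a `10`-cycle with code `s`: for some presentation `(v_0, …, v_9)` of the
cycle, `v_j v_{j+1}` is a link exactly when `s_j = 0` (indices modulo `10`). All rotations and
reflections of a presentation are presentations of the same cycle. -/
def HasTenCycleWithCode (m n : ℕ) (k ℓ : ZMod n) (s : Fin 10 → Fin 2) : Prop :=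
  ∃ v : Fin 10 → Vertex m n, Function.Injective v ∧
    (∀ j, (Xa m n k ℓ).Adj (v j) (v (j + 1))) ∧
    (∀ j, s j = 0 ↔ IsLink ℓ (v j) (v (j + 1)))

/-- Type `2`: code `1^6 0 1^2 0`. -/
def HasTenCycleType2 (m n : ℕ) (k ℓ : ZMod n) : Prop :=
  HasTenCycleWithCode m n k ℓ ![1, 1, 1, 1, 1, 1, 0, 1, 1, 0]

/-- Type `3`: code `1^3 0 1 0 1 0 1 0`. -/
def HasTenCycleType3 (m n : ℕ) (k ℓ : ZMod n) : Prop :=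
  HasTenCycleWithCode m n k ℓ ![1, 1, 1, 0, 1, 0, 1, 0, 1, 0]

/-- The basic parameter changes `(k,ℓ) ↦ (k',ℓ')` for fixed `m` and `n`: `(-k,ℓ)`, `(k,-ℓ)` and,
when `4 ∣ n` and `n = 2n'`, `(k+n',ℓ)` if `4 ∣ m` and `(k+n',ℓ+n')` otherwise. -/
inductive ParamStep (m n : ℕ) : ZMod n × ZMod n → ZMod n × ZMod n → Prop
  | neg_k (k ℓ : ZMod n) : ParamStep m n (k, ℓ) (-k, ℓ)
  | neg_ℓ (k ℓ : ZMod n) : ParamStep m n (k, ℓ) (k, -ℓ)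
  | shift_k (k ℓ : ZMod n) (hn : 4 ∣ n) (hm : 4 ∣ m) :
      ParamStep m n (k, ℓ) (k + ((n / 2 : ℕ) : ZMod n), ℓ)
  | shift_k_ℓ (k ℓ : ZMod n) (hn : 4 ∣ n) (hm : ¬ 4 ∣ m) :
      ParamStep m n (k, ℓ) (k + ((n / 2 : ℕ) : ZMod n), ℓ + ((n / 2 : ℕ) : ZMod n))

/-- `(k',ℓ')` is obtained from `(k,ℓ)` by finitely many basic parameter changes. -/
def ParamEquiv (m n : ℕ) : ZMod n × ZMod n → ZMod n × ZMod n → Prop :=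
  Relation.ReflTransGen (ParamStep m n)

end AltCycle

namespace AltCycle

/-! The graph is cubic. It is covered by a graph on `ℤ³` in which moves along even rows change `a`
and moves along odd rows change `b`, so local questions become finite computations. From `4 * k =
4`, `2 * k ≠ 2` and `k` odd one gets `n = 8t` and `k = 1 + 2t` or `1 + 6t`. The case `n = 16`
contains a `10`-cycle of type 2, so `n ≥ 24`, and then short closed walks close only when this is
forced by `4 * k = 4`, or by going once around the rows when `m = 4`, which for the walks in
question gives type 3.

The property `Branches` of a path on four vertices is preserved by automorphisms. Three consecutive
steps in row `0` never branch (`not_branches_row`), whereas leaving the zigzag of alternating links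
and non-links does (`branches_zig`). Hence an automorphism fixing `u_{0,0}` and interchanging
`u_{1,0}` with `u_{0,1}` maps row `0` onto the zigzag vertex by vertex, and so does its inverse
(`zig_of_row`).

Arithmetic follows in `parameters_of_reflection`. The vertex `u_{0,2k}` is `u_{0,2+4t}`, and its
image is also found locally to be `u_{1,2-k}`. Comparing rows gives `n = 4 n₀ m`; comparing columns
gives `s = 2 m y` for the displacement `s` of one full turn of the zigzag. Computing the image of
`u_{0,s}` in two ways gives `2 n₀ ∣ y² - 1`. What remains is to normalise `k` by explicit
isomorphisms and to rewrite this in terms of `ℓ₀`. The case of `u_{0,-1}` is reduced to that of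
`u_{0,1}` by the reflection `j ↦ -j`. -/

/-! ### The covering graph on `ℤ³` -/

/-- The parameter restrictions under which `X_a(m,n,k,ℓ)` is covered by an infinite graph on `ℤ³`. -/
structure Liftable (m n : ℕ) (k ℓ : ZMod n) : Prop where
  four_le_m : 4 ≤ m
  even_m : Even m
  fourteen_le_n : 14 ≤ n
  even_n : Even n
  odd_k : Odd k.val
  even_ℓ : Even ℓ.val

/-- The parameter restrictions under which the `10`-cycles of `X_a(m,n,k,ℓ)` are analysed. -/
structure Generic (m n : ℕ) (k ℓ : ZMod n) : Prop extends Liftable m n k ℓ where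
  large_n : 24 ≤ n
  four_k : 4 * k = 4
  two_k : 2 * k ≠ 2

/-- The vertex of `X_a(m,n,k,ℓ)` covered by `(r, a, b)`: row `r`, column `a + b k`, shifted by `ℓ`
each time the rows wrap around. -/
def proj (m : ℕ) {n : ℕ} (k ℓ : ZMod n) (x : ℤ × ℤ × ℤ) : Vertex m n :=
  ((x.1 : ZMod m), (x.2.1 : ZMod n) + (x.2.2 : ZMod n) * k + ((x.1 / (m : ℤ) : ℤ) : ZMod n) * ℓ)

/-- The neighbours of `(r, a, b)` in the cover: `0` is the link, `1` and `2` are the non-links. -/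
def step (x : ℤ × ℤ × ℤ) (d : Fin 3) : ℤ × ℤ × ℤ :=
  if d = 0 then
    (if (x.1 + x.2.1 + x.2.2) % 2 = 0 then (x.1 + 1, x.2.1, x.2.2) else (x.1 - 1, x.2.1, x.2.2))
  else if d = 1 then
    (if x.1 % 2 = 0 then (x.1, x.2.1 + 1, x.2.2) else (x.1, x.2.1, x.2.2 + 1))
  else
    (if x.1 % 2 = 0 then (x.1, x.2.1 - 1, x.2.2) else (x.1, x.2.1, x.2.2 - 1))

/-- Since `n` is even, reduction modulo 2 is a ring homomorphism on `ZMod n`; it sends `k` to 1 and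
`ℓ` to 0. Thus wrapping around the rows does not affect parity in the cover. -/
theorem val_mod_two_of_lift {n : ℕ} (hn : Even n) (hpos : 0 < n) {k ℓ : ZMod n} (hk : Odd k.val)
    (hℓ : Even ℓ.val) (a b c : ℤ) :
    ((((a : ZMod n) + (b : ZMod n) * k + (c : ZMod n) * ℓ).val : ℕ) : ℤ) % 2 = (a + b) % 2 := by
  have : NeZero n := ⟨hpos.ne'⟩
  have key : ∀ j : ZMod n, ((j.val : ℕ) : ZMod 2) = ZMod.castHom hn.two_dvd (ZMod 2) j := by
    intro j
    conv_rhs => rw [← ZMod.natCast_zmod_val j]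
    rw [map_natCast]
  have hk' : ZMod.castHom hn.two_dvd (ZMod 2) k = 1 := by
    rw [← key]; exact (ZMod.natCast_eq_one_iff_odd).2 hk
  have hℓ' : ZMod.castHom hn.two_dvd (ZMod 2) ℓ = 0 := by
    rw [← key]; exact (ZMod.natCast_eq_zero_iff_even).2 hℓ
  have h := key ((a : ZMod n) + (b : ZMod n) * k + (c : ZMod n) * ℓ)
  rw [map_add, map_add, map_mul, map_mul, hk', hℓ', map_intCast, map_intCast] at h
  have h2 : ((((((a : ZMod n) + (b : ZMod n) * k + (c : ZMod n) * ℓ).val : ℕ) : ℤ) : ZMod 2))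
      = ((a + b : ℤ) : ZMod 2) := by
    push_cast; rw [h]; ring
  exact (ZMod.intCast_eq_intCast_iff' _ _ 2).1 h2

theorem even_val_neg {n : ℕ} (hn : Even n) (hpos : 0 < n) {ℓ : ZMod n} (hℓ : Even ℓ.val) : Even (-ℓ).val := by
  have : NeZero n := ⟨hpos.ne'⟩
  rw [ZMod.neg_val]
  split_ifs with h
  · simp
  · exact (Nat.even_sub (ZMod.val_lt ℓ).le).2 (by simp [hn, hℓ])

variable {m n : ℕ} {k ℓ : ZMod n}

theorem sameParity_proj (h : Liftable m n k ℓ) (x : ℤ × ℤ × ℤ) :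
    SameParity (proj m k ℓ x).1 (proj m k ℓ x).2 ↔ (x.1 + x.2.1 + x.2.2) % 2 = 0 := by
  have h1 := val_mod_two_of_lift h.even_n (by have := h.fourteen_le_n; omega) h.odd_k h.even_ℓ
    x.2.1 x.2.2 (x.1 / (m : ℤ))
  have : NeZero m := ⟨by have := h.four_le_m; omega⟩
  have h2 : (((x.1 : ZMod m).val : ℕ) : ℤ) = x.1 % m := ZMod.val_intCast _
  obtain ⟨c, hc⟩ := h.even_m
  have h3 : x.1 % m % 2 = x.1 % 2 := Int.emod_emod_of_dvd _ ⟨c, by omega⟩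
  unfold SameParity proj
  simp only
  omega

theorem val_row (h : Liftable m n k ℓ) (r : ℤ) : (((r : ZMod m).val : ℕ) : ℤ) = r % m := by
  have : NeZero m := ⟨by have := h.four_le_m; omega⟩
  exact ZMod.val_intCast _

theorem ediv_succ_of_lt (h : Liftable m n k ℓ) {r : ℤ} (hr : (r : ZMod m).val + 1 < m) :
    (r + 1) / (m : ℤ) = r / m := by
  have h1 := val_row h r
  have h2 := Int.emod_add_mul_ediv r m
  have h4 := h.four_le_m
  have h3 := Int.emod_nonneg r (b := (m : ℤ)) (by omega)
  exact Int.ediv_eq_iff_of_pos (by omega) |>.2 ⟨by nlinarith, by nlinarith⟩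

theorem ediv_succ_of_eq (h : Liftable m n k ℓ) {r : ℤ} (hr : (r : ZMod m).val + 1 = m) :
    (r + 1) / (m : ℤ) = r / m + 1 := by
  have h1 := val_row h r
  have h2 := Int.emod_add_mul_ediv r m
  have h4 := h.four_le_m
  have h3 : r + 1 = m * (r / m + 1) := by linarith [mul_add (m : ℤ) (r / m) 1, (by omega : r % m + 1 = m)]
  rw [h3]
  exact Int.mul_ediv_cancel_left _ (by omega)

theorem val_add_one_le (h : Liftable m n k ℓ) (i : ZMod m) : i.val + 1 < m ∨ i.val + 1 = m := by
  have : NeZero m := ⟨by have := h.four_le_m; omega⟩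
  have := ZMod.val_lt i
  omega

theorem add_one_eq_zero_of_val (h : Liftable m n k ℓ) {i : ZMod m} (hi : i.val + 1 = m) :
    i + 1 = 0 := by
  have : NeZero m := ⟨by have := h.four_le_m; omega⟩
  have := congrArg (Nat.cast : ℕ → ZMod m) hi
  simpa using this

/-- The upper neighbour of a lift. -/
theorem linkTo_proj (h : Liftable m n k ℓ) (x : ℤ × ℤ × ℤ) (w : Vertex m n) :
    LinkTo ℓ (proj m k ℓ x) w ↔
      (x.1 + x.2.1 + x.2.2) % 2 = 0 ∧ w = proj m k ℓ (x.1 + 1, x.2.1, x.2.2) := by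
  unfold LinkTo
  rw [sameParity_proj h]
  refine and_congr_right fun _ => ?_
  have hx : (proj m k ℓ x).1 = (x.1 : ZMod m) := rfl
  rw [hx]
  rcases val_add_one_le h (x.1 : ZMod m) with hv | hv
  · rw [show w = proj m k ℓ (x.1 + 1, x.2.1, x.2.2) ↔ w = ((x.1 : ZMod m) + 1, (proj m k ℓ x).2) by
      simp [proj, ediv_succ_of_lt h hv]]
    constructor
    · rintro (⟨-, h1⟩ | ⟨h1, -⟩)
      · exact h1
      · omega
    · exact fun h1 => Or.inl ⟨hv, h1⟩
  · rw [show w = proj m k ℓ (x.1 + 1, x.2.1, x.2.2) ↔ w = (0, (proj m k ℓ x).2 + ℓ) by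
      simp only [proj, ediv_succ_of_eq h hv]
      push_cast
      rw [add_one_eq_zero_of_val h hv]
      ring_nf]
    constructor
    · rintro (⟨h1, -⟩ | ⟨-, h1⟩)
      · omega
      · exact h1
    · exact fun h1 => Or.inr ⟨hv, h1⟩

/-- A vertex linked upwards to `proj x` is covered by the lower neighbour of `x`. -/
theorem linkTo_proj_right (h : Liftable m n k ℓ) (x : ℤ × ℤ × ℤ) (w : Vertex m n) :
    LinkTo ℓ w (proj m k ℓ x) ↔
      (x.1 + x.2.1 + x.2.2) % 2 = 1 ∧ w = proj m k ℓ (x.1 - 1, x.2.1, x.2.2) := by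
  constructor
  · intro hw
    have hp := hw.1
    have hrow : w.1 + 1 = (x.1 : ZMod m) := by
      rcases hw.2 with ⟨_, h2⟩ | ⟨h1, h2⟩
      · exact (congrArg Prod.fst h2).symm
      · rw [add_one_eq_zero_of_val h h1]; exact (congrArg Prod.fst h2).symm
    have hw1 : w.1 = ((x.1 - 1 : ℤ) : ZMod m) := by
      push_cast; rw [← hrow]; ring
    have hweq : w = proj m k ℓ (x.1 - 1, x.2.1, x.2.2) := by
      refine Prod.ext hw1 ?_
      rcases hw.2 with ⟨h1, h2⟩ | ⟨h1, h2⟩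
      · rw [hw1] at h1
        have := ediv_succ_of_lt h h1
        rw [sub_add_cancel] at this
        rw [show w.2 = (proj m k ℓ x).2 from (congrArg Prod.snd h2).symm]
        simp only [proj, this]
      · rw [hw1] at h1
        have := ediv_succ_of_eq h h1
        rw [sub_add_cancel] at this
        have h3 : w.2 + ℓ = (proj m k ℓ x).2 := (congrArg Prod.snd h2).symm
        rw [← add_left_inj ℓ, h3]
        simp only [proj, this]
        push_cast
        ring
    refine ⟨?_, hweq⟩
    rw [hweq, sameParity_proj h] at hp
    simp only at hp
    omega
  · rintro ⟨h1, rfl⟩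
    rw [linkTo_proj h]
    refine ⟨by simp only; omega, ?_⟩
    simp

theorem isLink_proj (h : Liftable m n k ℓ) (x : ℤ × ℤ × ℤ) (w : Vertex m n) :
    IsLink ℓ (proj m k ℓ x) w ↔ w = proj m k ℓ (step x 0) := by
  unfold IsLink
  rw [linkTo_proj h, linkTo_proj_right h]
  rcases Int.emod_two_eq (x.1 + x.2.1 + x.2.2) with hp | hp <;> simp [step, hp]

theorem altEntry_proj (h : Liftable m n k ℓ) (x : ℤ × ℤ × ℤ) :
    altEntry k (proj m k ℓ x).1 = if x.1 % 2 = 0 then 1 else k := by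
  have h1 := val_row h x.1
  obtain ⟨c, hc⟩ := h.even_m
  have h3 : x.1 % m % 2 = x.1 % 2 := Int.emod_emod_of_dvd _ ⟨c, by omega⟩
  have : (proj m k ℓ x).1.val % 2 = 0 ↔ x.1 % 2 = 0 := by
    change (x.1 : ZMod m).val % 2 = 0 ↔ _
    omega
  unfold altEntry
  simp [this]

theorem proj_step_one (h : Liftable m n k ℓ) (x : ℤ × ℤ × ℤ) :
    proj m k ℓ (step x 1) = ((proj m k ℓ x).1, (proj m k ℓ x).2 + altEntry k (proj m k ℓ x).1) := by
  rw [altEntry_proj h]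
  rcases Int.emod_two_eq x.1 with hp | hp <;> simp [step, hp, proj] <;> ring

theorem proj_step_two (h : Liftable m n k ℓ) (x : ℤ × ℤ × ℤ) :
    proj m k ℓ (step x 2) =
      ((proj m k ℓ x).1, (proj m k ℓ x).2 + -altEntry k (proj m k ℓ x).1) := by
  rw [altEntry_proj h]
  rcases Int.emod_two_eq x.1 with hp | hp <;> simp [step, hp, proj] <;> ring

theorem altEntry_ne_zero (h : Liftable m n k ℓ) (i : ZMod m) : altEntry k i ≠ 0 := by
  have : Fact (1 < n) := ⟨by have := h.fourteen_le_n; omega⟩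
  unfold altEntry
  split_ifs
  · exact one_ne_zero
  · rintro rfl
    simpa using h.odd_k

/-- `NonLinkTo` lists a non-link only at its end with `j ≡ i`. As 1 and `k` are odd, a non-link at a
vertex of the other parity is listed at its other end. -/
theorem nonLinkTo_odd_odd {i : ZMod m} {j : ZMod n} (h : Liftable m n k ℓ)
    (hs : ¬ SameParity i j) : SameParity i (j + altEntry k i) ∧ SameParity i (j - altEntry k i) := by
  have : NeZero n := ⟨by have := h.fourteen_le_n; omega⟩
  have hpos : 0 < n := by have := h.fourteen_le_n; omega
  have hj : j = ((j.val : ℤ) : ZMod n) := by simp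
  have key : ∀ a b : ℤ, (((a : ZMod n) + (b : ZMod n) * k).val : ℤ) % 2 = (a + b) % 2 := by
    intro a b
    have := val_mod_two_of_lift h.even_n hpos h.odd_k h.even_ℓ a b 0
    simpa using this
  have h1 := key (j.val + 1) 0
  have h2 := key (j.val - 1) 0
  have h3 := key j.val 1
  have h4 := key j.val (-1)
  have e1 : ((j.val + 1 : ℤ) : ZMod n) + ((0 : ℤ) : ZMod n) * k = j + 1 := by simp
  have e2 : ((j.val - 1 : ℤ) : ZMod n) + ((0 : ℤ) : ZMod n) * k = j - 1 := by simp
  have e3 : ((j.val : ℤ) : ZMod n) + ((1 : ℤ) : ZMod n) * k = j + k := by simp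
  have e4 : ((j.val : ℤ) : ZMod n) + ((-1 : ℤ) : ZMod n) * k = j - k := by simp; ring
  rw [e1] at h1; rw [e2] at h2; rw [e3] at h3; rw [e4] at h4
  unfold SameParity at *
  unfold altEntry
  split_ifs <;> omega

/-- The projection is a bijection between the neighbours of `x` and those of its image. -/
theorem adj_proj (h : Liftable m n k ℓ) (x : ℤ × ℤ × ℤ) (w : Vertex m n) :
    (Xa m n k ℓ).Adj (proj m k ℓ x) w ↔ ∃ d, w = proj m k ℓ (step x d) := by
  have hrow : ∀ i : ZMod m, i + 1 ≠ i := by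
    have : Fact (1 < m) := ⟨by have := h.four_le_m; omega⟩
    intro i hi
    exact one_ne_zero (add_eq_left.1 hi)
  rw [Fin.exists_fin_succ, Fin.exists_fin_two]
  change _ ↔ (w = proj m k ℓ (step x 0) ∨ (w = proj m k ℓ (step x 1) ∨ w = proj m k ℓ (step x 2)))
  rw [← isLink_proj h, proj_step_one h, proj_step_two h]
  set v := proj m k ℓ x with hv
  have hne := altEntry_ne_zero h v.1
  unfold Xa XaSignature
  rw [SimpleGraph.fromRel_adj]
  constructor
  · rintro ⟨_, (h1 | h1) | (h1 | h1)⟩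
    · exact Or.inl (Or.inl h1)
    · exact Or.inr h1.2
    · exact Or.inl (Or.inr h1)
    · have hrow : v.1 = w.1 := by rcases h1.2 with h2 | h2 <;> rw [h2]
      refine Or.inr ?_
      rcases h1.2 with h2 | h2
      · right
        refine Prod.ext hrow.symm ?_
        rw [hrow, h2]
        simp
      · left
        refine Prod.ext hrow.symm ?_
        rw [hrow, h2]
        simp
  · intro h1
    have hvw : v ≠ w := by
      rintro rfl
      rcases h1 with h1 | h1 | h1
      · have : v.1 + 1 = v.1 := by
          rcases h1 with h1 | h1 <;>
          · rcases h1.2 with ⟨_, h2⟩ | ⟨h3, h2⟩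
            · exact (congrArg Prod.fst h2).symm
            · rw [add_one_eq_zero_of_val h h3]; exact (congrArg Prod.fst h2).symm
        exact hrow _ this
      · have := congrArg Prod.snd h1
        simp only [left_eq_add] at this
        exact hne this
      · have := congrArg Prod.snd h1
        simp only [left_eq_add, neg_eq_zero] at this
        exact hne this
    refine ⟨hvw, ?_⟩
    rcases h1 with (h1 | h1) | h1
    · exact Or.inl (Or.inl h1)
    · exact Or.inr (Or.inl h1)
    · by_cases hs : SameParity v.1 v.2
      · exact Or.inl (Or.inr ⟨hs, h1⟩)
      · refine Or.inr (Or.inr ?_)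
        have hso := nonLinkTo_odd_odd h hs
        rcases h1 with rfl | rfl
        · exact ⟨hso.1, Or.inr (by simp)⟩
        · exact ⟨by simpa [sub_eq_add_neg] using hso.2, Or.inl (by simp)⟩

/-! ### Coincidences between nearby lifts -/

theorem int_eq_zero_of_cast {n : ℕ} {s : ℤ} (h : (s : ZMod n) = 0) (h1 : |s| < n) : s = 0 :=
  Int.eq_zero_of_abs_lt_dvd ((ZMod.intCast_zmod_eq_zero_iff_dvd s n).1 h) h1

/-- The columns `a + b k` that vanish, for small `a + b`. -/
theorem column_eq_zero (h : Generic m n k ℓ) {a b : ℤ}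
    (h0 : (a : ZMod n) + (b : ZMod n) * k = 0)
    (hs : |a + b| < 6 ∨ (a % 2 = 0 ∧ b % 2 = 0 ∧ |a + b| < 12)) : a + b = 0 ∧ b % 4 = 0 := by
  have hn := h.large_n
  have h4 := h.four_k
  -- Multiplying `a + b k = 0` by 4 gives `4 (a + b) = 0`, by `4 * k = 4`. For even `b` a factor 2
  -- suffices, which doubles the admissible range. Both bounds are matched to `24 ≤ n`.
  have hz : a + b = 0 := by
    rcases hs with hs | ⟨_, hb, hs⟩
    · have : ((4 * (a + b) : ℤ) : ZMod n) = 0 := by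
        push_cast
        linear_combination 4 * h0 - (b : ZMod n) * h4
      have := int_eq_zero_of_cast this (by rw [abs_mul]; norm_num; omega)
      omega
    · obtain ⟨c, rfl⟩ : ∃ c, b = 2 * c := ⟨b / 2, by omega⟩
      have : ((2 * (a + 2 * c) : ℤ) : ZMod n) = 0 := by
        push_cast at h0 ⊢
        linear_combination 2 * h0 - (c : ZMod n) * h4
      have := int_eq_zero_of_cast this (by rw [abs_mul]; norm_num; omega)
      omega
  refine ⟨hz, ?_⟩
  have ha : (a : ZMod n) = -(b : ZMod n) := by
    have : a = -b := by omega
    rw [this]; push_cast; ring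
  rw [ha] at h0
  -- Now `b (k - 1) = 0` and `4 (k - 1) = 0`; if `4 ∤ b`, these force `2 (k - 1) = 0`.
  by_contra hb
  apply h.two_k
  obtain ⟨c, hc | hc | hc⟩ : ∃ c, b = 4 * c + 1 ∨ b = 4 * c + 2 ∨ b = 4 * c + 3 :=
    ⟨b / 4, by omega⟩ <;> rw [hc] at h0 <;> push_cast at h0
  · linear_combination 2 * h0 - 2 * (c : ZMod n) * h4
  · linear_combination h0 - (c : ZMod n) * h4
  · linear_combination -2 * h0 + (2 * (c : ZMod n) + 2) * h4

theorem column_of_mod_four (h : Generic m n k ℓ) {a b : ℤ} (h1 : a + b = 0) (h2 : b % 4 = 0) :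
    (a : ZMod n) + (b : ZMod n) * k = 0 := by
  obtain ⟨c, rfl⟩ : ∃ c, b = 4 * c := ⟨b / 4, by omega⟩
  obtain rfl : a = -(4 * c) := by omega
  push_cast
  linear_combination (c : ZMod n) * h.four_k

theorem row_eq_iff (r s : ℤ) : (r : ZMod m) = (s : ZMod m) ↔ (m : ℤ) ∣ r - s := by
  rw [← sub_eq_zero, ← Int.cast_sub, ZMod.intCast_zmod_eq_zero_iff_dvd]

/-- Lifts whose rows differ by less than `m` have the same image only in the obvious case. -/
theorem proj_eq (x y : ℤ × ℤ × ℤ) (hxy : proj m k ℓ x = proj m k ℓ y)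
    (hr : |x.1 - y.1| < m) : x.1 = y.1 ∧
      ((x.2.1 - y.2.1 : ℤ) : ZMod n) + ((x.2.2 - y.2.2 : ℤ) : ZMod n) * k = 0 := by
  have h1 := (row_eq_iff x.1 y.1).1 (congrArg Prod.fst hxy)
  have h2 : x.1 = y.1 := by linarith [Int.eq_zero_of_abs_lt_dvd h1 hr]
  refine ⟨h2, ?_⟩
  have h3 := congrArg Prod.snd hxy
  simp only [proj, h2, add_left_inj] at h3
  push_cast
  linear_combination h3

theorem proj_eq_of {x y : ℤ × ℤ × ℤ} (h : Generic m n k ℓ) (h1 : x.1 = y.1)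
    (h2 : x.2.1 + x.2.2 = y.2.1 + y.2.2) (h3 : (x.2.2 - y.2.2) % 4 = 0) :
    proj m k ℓ x = proj m k ℓ y := by
  have := column_of_mod_four h (a := x.2.1 - y.2.1) (b := x.2.2 - y.2.2) (by omega) h3
  refine Prod.ext (by simp [proj, h1]) ?_
  simp only [proj, h1, add_left_inj]
  push_cast at this
  linear_combination this

/-- Lifts close to each other with different images. -/
def Apart (x y : ℤ × ℤ × ℤ) : Prop :=
  |x.1 - y.1| < 4 ∧ (x.1 = y.1 → |x.2.1 - y.2.1 + (x.2.2 - y.2.2)| < 6 ∧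
    ¬ (x.2.1 + x.2.2 = y.2.1 + y.2.2 ∧ (x.2.2 - y.2.2) % 4 = 0))

instance (x y : ℤ × ℤ × ℤ) : Decidable (Apart x y) := by unfold Apart; infer_instance

theorem Apart.proj_ne (h : Generic m n k ℓ) {x y : ℤ × ℤ × ℤ} (hxy : Apart x y) :
    proj m k ℓ x ≠ proj m k ℓ y := by
  intro he
  have hm := h.four_le_m
  obtain ⟨h1, h2⟩ := proj_eq x y he (by have := hxy.1; omega)
  obtain ⟨h3, h4⟩ := hxy.2 h1
  have := column_eq_zero h h2 (Or.inl h3)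
  exact h4 ⟨by omega, this.2⟩

/-- The rules of `step` depend only on the parities of `r` and `r + a + b`. This lets a check at one
base point serve for all its translates. -/
theorem step_add {x τ : ℤ × ℤ × ℤ} (h1 : τ.1 % 2 = 0) (h2 : (τ.2.1 + τ.2.2) % 2 = 0) (d : Fin 3) :
    step (x + τ) d = step x d + τ := by
  obtain ⟨r, a, b⟩ := x
  obtain ⟨r', a', b'⟩ := τ
  simp only at h1 h2
  have e1 : (r + r') % 2 = 0 ↔ r % 2 = 0 := by omega
  have e2 : (r + r' + (a + a') + (b + b')) % 2 = 0 ↔ (r + a + b) % 2 = 0 := by omega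
  simp only [step, Prod.mk_add_mk, e1, e2]
  split_ifs <;> refine Prod.ext ?_ (Prod.ext ?_ ?_) <;> simp only [Prod.mk_add_mk] <;> ring

/-- In `Fin 3` negation fixes 0 and exchanges 1 and 2, so `-d` is the letter that undoes `d`. -/
theorem step_step_neg (x : ℤ × ℤ × ℤ) (d : Fin 3) : step (step x d) (-d) = x := by
  obtain ⟨r, a, b⟩ := x
  have hd : d = 0 ∨ d = 1 ∨ d = 2 := by revert d; decide
  obtain rfl | rfl | rfl := hd
  · rw [show -(0 : Fin 3) = 0 from rfl]
    rcases Int.emod_two_eq (r + a + b) with hp | hp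
    · have : (r + 1 + a + b) % 2 ≠ 0 := by omega
      simp [step, hp, this]
    · have : (r - 1 + a + b) % 2 = 0 := by omega
      simp [step, hp, this]
  · rw [show -(1 : Fin 3) = 2 from rfl]
    rcases Int.emod_two_eq r with hp | hp <;> simp [step, hp]
  · rw [show -(2 : Fin 3) = 1 from rfl]
    rcases Int.emod_two_eq r with hp | hp <;> simp [step, hp]

theorem isLink_step (h : Liftable m n k ℓ) (x : ℤ × ℤ × ℤ) (d : Fin 3) :
    IsLink ℓ (proj m k ℓ x) (proj m k ℓ (step x d)) ↔ d = 0 := by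
  rw [isLink_proj h]
  refine ⟨fun he => ?_, fun hd => by rw [hd]⟩
  by_contra hd
  have hm := h.four_le_m
  have h1 : (step x d).1 = x.1 := by
    simp only [step, hd, if_false]; split_ifs <;> rfl
  have h0 : (step x 0).1 = x.1 + 1 ∨ (step x 0).1 = x.1 - 1 := by
    simp only [step, if_true]; split_ifs <;> simp
  have := proj_eq _ _ he (by rw [h1, abs_lt]; omega)
  omega

/-! ### Words, `10`-cycles and branching paths -/

/-- The `j`-th vertex of the walk from `x` spelled by `w`. -/
def pos (x : ℤ × ℤ × ℤ) (w : List (Fin 3)) : ℕ → ℤ × ℤ × ℤ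
  | 0 => x
  | j + 1 => step (pos x w j) (w.getD j 0)

theorem pos_add {x τ : ℤ × ℤ × ℤ} (h1 : τ.1 % 2 = 0) (h2 : (τ.2.1 + τ.2.2) % 2 = 0)
    (w : List (Fin 3)) (j : ℕ) : pos (x + τ) w j = pos x w j + τ := by
  induction j with
  | zero => rfl
  | succ j ih => rw [pos, ih, step_add h1 h2, pos]

/-- `v` is a presentation of a `10`-cycle. -/
def IsTenCycle {V : Type*} (G : SimpleGraph V) (v : Fin 10 → V) : Prop :=
  Function.Injective v ∧ ∀ j, G.Adj (v j) (v (j + 1))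

theorem Apart.symm {x y : ℤ × ℤ × ℤ} (h : Apart x y) : Apart y x := by
  obtain ⟨h1, h2⟩ := h
  refine ⟨by rwa [abs_sub_comm], fun he => ?_⟩
  obtain ⟨h3, h4⟩ := h2 he.symm
  refine ⟨?_, fun h5 => h4 ⟨h5.1.symm, by omega⟩⟩
  rw [abs_lt] at h3 ⊢
  omega

theorem Apart.add {x y : ℤ × ℤ × ℤ} (h : Apart x y) (τ : ℤ × ℤ × ℤ) : Apart (x + τ) (y + τ) := by
  obtain ⟨h1, h2⟩ := h
  simp only [Apart, Prod.fst_add, Prod.snd_add]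
  refine ⟨by rwa [add_sub_add_right_eq_sub], fun he => ?_⟩
  obtain ⟨h3, h4⟩ := h2 (by omega)
  refine ⟨?_, fun h5 => h4 ⟨by omega, by omega⟩⟩
  rw [abs_lt] at h3 ⊢
  omega

/-- A word that spells a `10`-cycle from `x`, whatever the parameters. -/
def Closes (x : ℤ × ℤ × ℤ) (w : List (Fin 3)) : Prop :=
  (∀ i j : Fin 10, i < j → Apart (pos x w i) (pos x w j)) ∧
    (pos x w 10).1 = x.1 ∧ (pos x w 10).2.1 + (pos x w 10).2.2 = x.2.1 + x.2.2 ∧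
    ((pos x w 10).2.2 - x.2.2) % 4 = 0

instance (x : ℤ × ℤ × ℤ) (w : List (Fin 3)) : Decidable (Closes x w) := by
  unfold Closes; infer_instance

theorem Closes.isTenCycle (h : Generic m n k ℓ) {x τ : ℤ × ℤ × ℤ} {w : List (Fin 3)}
    (hw : Closes x w) (h1 : τ.1 % 2 = 0) (h2 : (τ.2.1 + τ.2.2) % 2 = 0) :
    IsTenCycle (Xa m n k ℓ) (fun j => proj m k ℓ (pos (x + τ) w j)) := by
  constructor
  · intro i j hij
    by_contra hne
    rcases lt_or_gt_of_ne hne with hlt | hlt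
    · refine ((hw.1 i j hlt).add τ).proj_ne h ?_
      rw [← pos_add h1 h2, ← pos_add h1 h2]; exact hij
    · refine ((hw.1 j i hlt).add τ).proj_ne h ?_
      rw [← pos_add h1 h2, ← pos_add h1 h2]; exact hij.symm
  · intro j
    simp only
    rw [adj_proj h.toLiftable]
    refine ⟨w.getD j 0, ?_⟩
    by_cases hj : j = 9
    · subst hj
      change proj m k ℓ (x + τ) = proj m k ℓ (pos (x + τ) w 10)
      rw [pos_add h1 h2]
      obtain ⟨-, h3, h4, h5⟩ := hw
      refine proj_eq_of h ?_ ?_ ?_ <;> simp only [Prod.fst_add, Prod.snd_add] <;> omega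
    · have : ((j + 1 : Fin 10) : ℕ) = (j : ℕ) + 1 := by
        rw [Fin.val_add_one_of_lt]
        exact lt_of_le_of_ne (Fin.le_last j) hj
      rw [this]; rfl

/-- Some continuation of the path `p₀ p₁ p₂ p₃` to a fifth vertex has two different continuations
that lie on `10`-cycles. -/
def Branches {V : Type*} (G : SimpleGraph V) (p₀ p₁ p₂ p₃ : V) : Prop :=
  ∃ v w : Fin 10 → V, IsTenCycle G v ∧ IsTenCycle G w ∧ v 0 = p₀ ∧ v 1 = p₁ ∧ v 2 = p₂ ∧ v 3 = p₃ ∧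
    w 0 = p₀ ∧ w 1 = p₁ ∧ w 2 = p₂ ∧ w 3 = p₃ ∧ v 4 = w 4 ∧ v 5 ≠ w 5

theorem IsTenCycle.map {V W : Type*} {G : SimpleGraph V} {H : SimpleGraph W} (θ : G ≃g H)
    {v : Fin 10 → V} (hv : IsTenCycle G v) : IsTenCycle H (fun j => θ (v j)) :=
  ⟨θ.injective.comp hv.1, fun j => θ.map_adj_iff.2 (hv.2 j)⟩

theorem Branches.map {V W : Type*} {G : SimpleGraph V} {H : SimpleGraph W} (θ : G ≃g H)
    {p₀ p₁ p₂ p₃ : V} (hp : Branches G p₀ p₁ p₂ p₃) : Branches H (θ p₀) (θ p₁) (θ p₂) (θ p₃) := by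
  obtain ⟨v, w, hv, hw, rfl, rfl, rfl, rfl, h0, h1, h2, h3, h4, h5⟩ := hp
  exact ⟨_, _, hv.map θ, hw.map θ, rfl, rfl, rfl, rfl, congrArg θ h0, congrArg θ h1,
    congrArg θ h2, congrArg θ h3, congrArg θ h4, fun he => h5 (θ.injective he)⟩

/-- Two words witnessing that their common initial segment branches. -/
def Splits (x : ℤ × ℤ × ℤ) (w w' : List (Fin 3)) : Prop :=
  Closes x w ∧ Closes x w' ∧ (∀ j : Fin 5, pos x w j = pos x w' j) ∧ Apart (pos x w 5) (pos x w' 5)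

instance (x : ℤ × ℤ × ℤ) (w w' : List (Fin 3)) : Decidable (Splits x w w') := by
  unfold Splits; infer_instance

theorem Splits.branches (h : Generic m n k ℓ) {x τ : ℤ × ℤ × ℤ} {w w' : List (Fin 3)}
    (hw : Splits x w w') (h1 : τ.1 % 2 = 0) (h2 : (τ.2.1 + τ.2.2) % 2 = 0) :
    Branches (Xa m n k ℓ) (proj m k ℓ (x + τ)) (proj m k ℓ (pos x w 1 + τ))
      (proj m k ℓ (pos x w 2 + τ)) (proj m k ℓ (pos x w 3 + τ)) := by
  obtain ⟨c1, c2, h3, h4⟩ := hw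
  have key : ∀ j : Fin 5, proj m k ℓ (pos (x + τ) w' j) = proj m k ℓ (pos x w j + τ) := by
    intro j; rw [pos_add h1 h2, h3]
  refine ⟨_, _, c1.isTenCycle h h1 h2, c2.isTenCycle h h1 h2, rfl, ?_, ?_, ?_, rfl,
    key 1, key 2, key 3, ?_, ?_⟩
  · exact congrArg _ (pos_add h1 h2 w 1)
  · exact congrArg _ (pos_add h1 h2 w 2)
  · exact congrArg _ (pos_add h1 h2 w 3)
  · exact (congrArg _ (pos_add h1 h2 w 4)).trans (key 4).symm
  · intro he
    refine (h4.add τ).proj_ne h ?_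
    rw [← pos_add h1 h2, ← pos_add h1 h2]
    exact he

/-! ### Which paths branch: row `0` against the zigzag -/

/-- The outcome `y` of a word with letters `1, 1, 1, d₃, …, d₉` starting at `(0, p, 0)`. -/
def RowOutcome (p : ℤ) (y : ℤ × ℤ × ℤ) (d₃ d₄ d₅ d₆ d₇ d₈ d₉ : Fin 3) : Prop :=
  (-4 ≤ y.1 ∧ y.1 ≤ 4) ∧
    (y.1 = 0 → (y.2.1 - p) % 2 = 0 ∧ y.2.2 % 2 = 0 ∧ (-12 < y.2.1 - p + y.2.2 ∧
        y.2.1 - p + y.2.2 < 12) ∧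
      (y.2.1 - p + y.2.2 = 0 → y.2.2 % 4 = 0 → (d₃ = 1 ∧ d₄ = 0) ∨ (d₃ = 0 ∧ d₄ = 2))) ∧
    (y.1 = 4 ∨ y.1 = -4 → d₃ = 0 ∧ d₄ ≠ 0 ∧ d₅ = 0 ∧ d₆ ≠ 0 ∧ d₇ = 0 ∧ d₈ ≠ 0 ∧ d₉ = 0)

instance (p : ℤ) (y : ℤ × ℤ × ℤ) (d₃ d₄ d₅ d₆ d₇ d₈ d₉ : Fin 3) :
    Decidable (RowOutcome p y d₃ d₄ d₅ d₆ d₇ d₈ d₉) := by unfold RowOutcome; infer_instance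

/-- The closed non-backtracking words of length `10` that start with three steps in row `0`. -/
theorem row_words : ∀ p : Fin 2, ∀ d₃ : Fin 3, d₃ ≠ 2 → ∀ d₄, d₄ ≠ -d₃ → ∀ d₅, d₅ ≠ -d₄ →
    ∀ d₆, d₆ ≠ -d₅ → ∀ d₇, d₇ ≠ -d₆ → ∀ d₈, d₈ ≠ -d₇ → ∀ d₉, d₉ ≠ -d₈ → d₉ ≠ 2 →
    RowOutcome p
      (step (step (step (step (step (step (step (0, (p : ℤ) + 3, 0) d₃) d₄) d₅) d₆) d₇) d₈) d₉)
      d₃ d₄ d₅ d₆ d₇ d₈ d₉ := by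
  decide +kernel

/-- This and the next three cover the residues of `t` modulo 4 in `branches_zig`. In each, the first
two letters follow the zigzag, the third leaves it, and the two words part at the fifth letter. -/
theorem splits_even_up : Splits (0, 0, 0) [0, 1, 1, 0, 1, 0, 2, 2, 0, 2]
    [0, 1, 1, 0, 2, 0, 2, 2, 0, 1] := by decide +kernel

theorem splits_odd_up : Splits (1, 0, 1) [0, 1, 1, 0, 1, 0, 2, 2, 0, 2]
    [0, 1, 1, 0, 2, 0, 2, 2, 0, 1] := by decide +kernel

theorem splits_even_right : Splits (1, 0, 0) [1, 0, 2, 2, 0, 2, 0, 1, 1, 0]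
    [1, 0, 2, 2, 2, 2, 0, 1, 1, 1] := by decide +kernel

theorem splits_odd_right : Splits (0, -1, 0) [1, 0, 2, 2, 0, 2, 0, 1, 1, 0]
    [1, 0, 2, 2, 2, 2, 0, 1, 1, 1] := by decide +kernel

theorem exists_eq_fin_two_add (c : ℤ) : ∃ (p : Fin 2) (e : ℤ), c = p + 2 * e := by
  rcases Int.emod_two_eq c with hc | hc
  · exact ⟨0, c / 2, by simp; omega⟩
  · exact ⟨1, c / 2, by simp; omega⟩

/-- A `10`-cycle that contains three consecutive steps in row `0`. -/
theorem tenCycle_of_row (h : Generic m n k ℓ) (h3 : ¬ HasTenCycleType3 m n k ℓ) (c : ℤ)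
    {v : Fin 10 → Vertex m n} (hv : IsTenCycle (Xa m n k ℓ) v) (v0 : v 0 = proj m k ℓ (0, c, 0))
    (v1 : v 1 = proj m k ℓ (0, c + 1, 0)) (v2 : v 2 = proj m k ℓ (0, c + 2, 0))
    (v3 : v 3 = proj m k ℓ (0, c + 3, 0)) :
    ∃ d₃ d₄ : Fin 3, v 4 = proj m k ℓ (step (0, c + 3, 0) d₃) ∧
      v 5 = proj m k ℓ (step (step (0, c + 3, 0) d₃) d₄) ∧
      ((d₃ = 1 ∧ d₄ = 0) ∨ (d₃ = 0 ∧ d₄ = 2)) := by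
  have next : ∀ {x j}, v j = proj m k ℓ x → ∃ d, v (j + 1) = proj m k ℓ (step x d) :=
    fun {x j} hx => (adj_proj h.toLiftable x _).1 (hx ▸ hv.2 j)
  have nb : ∀ j : Fin 10, j + 1 + 1 ≠ j := by decide
  have back : ∀ {x j d d'}, v j = proj m k ℓ x → v (j + 1 + 1) = proj m k ℓ (step (step x d) d') →
      d' ≠ -d := by
    rintro x j d _ hx hx' rfl
    rw [step_step_neg, ← hx] at hx'
    exact nb j (hv.1 hx')
  have s2 : step (0, c + 2, 0) 1 = (0, c + 3, 0) := by simp [step]; ring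
  obtain ⟨d₃, v4⟩ := next v3
  obtain ⟨d₄, v5⟩ := next v4
  obtain ⟨d₅, v6⟩ := next v5
  obtain ⟨d₆, v7⟩ := next v6
  obtain ⟨d₇, v8⟩ := next v7
  obtain ⟨d₈, v9⟩ := next v8
  obtain ⟨d₉, v10⟩ := next v9
  have n3 : d₃ ≠ 2 := back v2 (by rw [s2]; exact v4)
  have n4 := back v3 v5
  have n5 := back v4 v6
  have n6 := back v5 v7
  have n7 := back v6 v8
  have n8 := back v7 v9
  have n9 := back v8 v10
  -- Non-backtracking where the cycle closes up: the first letter is 1, so a last letter 2 would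
  -- give `v 9 = v 1`.
  have n10 : d₉ ≠ 2 := by
    rintro rfl
    have e1 := v10.symm.trans v0
    have e2 : v 1 = v 9 := by
      have s0 : step (0, c, 0) 1 = (0, c + 1, 0) := by simp [step]
      refine Eq.trans ?_ v9.symm
      rw [v1, ← s0, ← step_step_neg (step _ d₈) 2, show -(2 : Fin 3) = 1 from rfl,
        proj_step_one h.toLiftable, proj_step_one h.toLiftable, e1]
    exact absurd (hv.1 e2) (by decide)
  refine ⟨d₃, d₄, v4, v5, ?_⟩
  -- Only the parity of `c` matters, by translation, so the enumeration over `p` applies.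
  obtain ⟨p, e, hc⟩ := exists_eq_fin_two_add c
  have out := row_words p d₃ n3 d₄ n4 d₅ n5 d₆ n6 d₇ n7 d₈ n8 d₉ n9 n10
  have t1 : ((0, 2 * e, 0) : ℤ × ℤ × ℤ).1 % 2 = 0 := rfl
  have t2 : (((0, 2 * e, 0) : ℤ × ℤ × ℤ).2.1 + ((0, 2 * e, 0) : ℤ × ℤ × ℤ).2.2) % 2 = 0 := by
    simp
  have hy : step (step (step (step (step (step (step (0, c + 3, 0) d₃) d₄) d₅) d₆) d₇) d₈) d₉ =
      step (step (step (step (step (step (step (0, (p : ℤ) + 3, 0) d₃) d₄) d₅) d₆) d₇) d₈) d₉ +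
        (0, 2 * e, 0) := by
    rw [show ((0, c + 3, 0) : ℤ × ℤ × ℤ) = (0, (p : ℤ) + 3, 0) + (0, 2 * e, 0) by
      simp [hc]; ring]
    simp only [step_add t1 t2]
  have hclose := v0.symm.trans v10
  rw [hy] at hclose
  revert out hclose
  generalize step (step (step (step (step (step (step (0, (p : ℤ) + 3, 0) d₃) d₄) d₅) d₆) d₇) d₈) d₉
    = y
  rintro ⟨o1, o2, o3⟩ hclose
  have hm := h.four_le_m
  have hrow := (row_eq_iff _ _).1 (congrArg Prod.fst hclose)
  simp only [Prod.fst_add, add_zero, zero_sub] at hrow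
  -- The row changes by a multiple of `m ≥ 4` and by at most 4; the values `±4` arise only for `m =
  -- 4`, and those words have the code of type 3.
  have hy0 : y.1 = 0 ∨ y.1 = 4 ∨ y.1 = -4 := by
    by_cases hlt : |-y.1| < m
    · left; linarith [Int.eq_zero_of_abs_lt_dvd hrow hlt]
    · right
      rw [abs_lt] at hlt
      omega
  rcases hy0 with hy0 | hy4
  · obtain ⟨a1, a2, a3, a4⟩ := o2 hy0
    obtain ⟨-, hcol⟩ := proj_eq _ _ hclose (by simp [hy0]; omega)
    simp only [Prod.snd_add, Prod.fst_add] at hcol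
    obtain ⟨z1, z2⟩ := column_eq_zero h hcol (Or.inr ⟨by omega, by omega, by rw [abs_lt]; omega⟩)
    exact a4 (by omega) (by omega)
  · exfalso
    obtain ⟨b3, b4, b5, b6, b7, b8, b9⟩ := o3 hy4
    refine h3 ⟨v, hv.1, hv.2, ?_⟩
    have code : ∀ {x j d}, v j = proj m k ℓ x → v (j + 1) = proj m k ℓ (step x d) →
        (IsLink ℓ (v j) (v (j + 1)) ↔ d = 0) := by
      intro x j d hx hx'
      rw [hx', hx, isLink_step h.toLiftable]
    have s0 : step (0, c, 0) 1 = (0, c + 1, 0) := by simp [step]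
    have s1 : step (0, c + 1, 0) 1 = (0, c + 2, 0) := by simp [step]; ring
    intro j
    fin_cases j
    · exact (iff_of_false (by decide) (by decide)).trans (code (d := 1) v0 (by rw [s0]; exact v1)).symm
    · exact (iff_of_false (by decide) (by decide)).trans (code (d := 1) v1 (by rw [s1]; exact v2)).symm
    · exact (iff_of_false (by decide) (by decide)).trans (code (d := 1) v2 (by rw [s2]; exact v3)).symm
    · exact (iff_of_true rfl b3).trans (code v3 v4).symm
    · exact (iff_of_false (by decide) b4).trans (code v4 v5).symm
    · exact (iff_of_true rfl b5).trans (code v5 v6).symm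
    · exact (iff_of_false (by decide) b6).trans (code v6 v7).symm
    · exact (iff_of_true rfl b7).trans (code v7 v8).symm
    · exact (iff_of_false (by decide) b8).trans (code v8 v9).symm
    · exact (iff_of_true rfl b9).trans (code v9 v10).symm

/-- The fourth letter is read off from the vertex `v 4`, and it determines the fifth. Two
`10`-cycles sharing `v 4` therefore share `v 5`. -/
theorem not_branches_row (h : Generic m n k ℓ) (h3 : ¬ HasTenCycleType3 m n k ℓ) (c : ℤ) :
    ¬ Branches (Xa m n k ℓ) (proj m k ℓ (0, c, 0)) (proj m k ℓ (0, c + 1, 0))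
      (proj m k ℓ (0, c + 2, 0)) (proj m k ℓ (0, c + 3, 0)) := by
  rintro ⟨v, w, hv, hw, v0, v1, v2, v3, w0, w1, w2, w3, h4, h5⟩
  obtain ⟨d₃, d₄, v4, v5, hd⟩ := tenCycle_of_row h h3 c hv v0 v1 v2 v3
  obtain ⟨e₃, e₄, w4, w5, he⟩ := tenCycle_of_row h h3 c hw w0 w1 w2 w3
  have hdist : proj m k ℓ (step (0, c + 3, 0) 1) ≠ proj m k ℓ (step (0, c + 3, 0) 0) := by
    intro heq
    have := (isLink_step h.toLiftable (0, c + 3, 0) 1).1 ((isLink_proj h.toLiftable _ _).2 heq)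
    exact absurd this (by decide)
  rcases hd with ⟨rfl, rfl⟩ | ⟨rfl, rfl⟩ <;> rcases he with ⟨rfl, rfl⟩ | ⟨rfl, rfl⟩
  · exact h5 (v5.trans w5.symm)
  · exact hdist (v4.symm.trans (h4.trans w4))
  · exact hdist (w4.symm.trans (h4.symm.trans v4))
  · exact h5 (v5.trans w5.symm)

/-! ### The zigzag and the image of row `0` -/

/-- The zigzag through `u_{0,-1}, u_{0,0}, u_{1,0}` that climbs to the right. -/
def zig (t : ℤ) : ℤ × ℤ × ℤ := ((t + 1) / 2, t / 4, (t + 2) / 4)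

/-- The letter that leads from `zig t` to `zig (t + 1)`. -/
def zigLetter (t : ℤ) : Fin 3 := if t % 2 = 0 then 0 else 1

theorem step_zig (t : ℤ) : step (zig t) (zigLetter t) = zig (t + 1) := by
  obtain ⟨e, he | he | he | he⟩ : ∃ e, t = 4 * e ∨ t = 4 * e + 1 ∨ t = 4 * e + 2 ∨ t = 4 * e + 3 :=
    ⟨t / 4, by omega⟩
  · have h1 : t % 2 = 0 := by omega
    have h2 : ((t + 1) / 2 + t / 4 + (t + 2) / 4) % 2 = 0 := by omega
    simp only [step, zig, zigLetter, h1, h2, if_true, Prod.mk.injEq]; omega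
  · have h1 : ¬ t % 2 = 0 := by omega
    have h2 : ¬ ((t + 1) / 2) % 2 = 0 := by omega
    simp only [step, zig, zigLetter, h1, h2, if_false, if_true, Prod.mk.injEq, one_ne_zero]; omega
  · have h1 : t % 2 = 0 := by omega
    have h2 : ((t + 1) / 2 + t / 4 + (t + 2) / 4) % 2 = 0 := by omega
    simp only [step, zig, zigLetter, h1, h2, if_true, Prod.mk.injEq]; omega
  · have h1 : ¬ t % 2 = 0 := by omega
    have h2 : ((t + 1) / 2) % 2 = 0 := by omega
    simp only [step, zig, zigLetter, h1, h2, if_false, if_true, Prod.mk.injEq, one_ne_zero]; omega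

/-- The letter that leads from `zig t` off the zigzag. -/
def zagLetter (t : ℤ) : Fin 3 := if t % 2 = 0 then 1 else 2

theorem eq_zigLetter_or (t : ℤ) (d : Fin 3) :
    d = zigLetter t ∨ d = -zigLetter (t - 1) ∨ d = zagLetter t := by
  rcases Int.emod_two_eq t with ht | ht
  · have : ¬ (t - 1) % 2 = 0 := by omega
    simp only [zigLetter, zagLetter, ht, this, if_true, if_false]
    revert d; decide
  · have : (t - 1) % 2 = 0 := by omega
    simp only [zigLetter, zagLetter, ht, this, if_true, if_false, one_ne_zero]
    revert d; decide

theorem step_zig_back (t : ℤ) : step (zig t) (-zigLetter (t - 1)) = zig (t - 1) := by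
  have := step_zig (t - 1)
  rw [sub_add_cancel] at this
  rw [← this, step_step_neg]

/-- Leaving the zigzag after three of its vertices gives a branching path. -/
theorem branches_zig (h : Generic m n k ℓ) (t : ℤ) :
    Branches (Xa m n k ℓ) (proj m k ℓ (zig t)) (proj m k ℓ (zig (t + 1)))
      (proj m k ℓ (zig (t + 2))) (proj m k ℓ (step (zig (t + 2)) (zagLetter (t + 2)))) := by
  have key : ∀ (x τ : ℤ × ℤ × ℤ) (w w' : List (Fin 3)), Splits x w w' → τ.1 % 2 = 0 →
      (τ.2.1 + τ.2.2) % 2 = 0 → zig t = x + τ → w.getD 0 0 = zigLetter t →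
      w.getD 1 0 = zigLetter (t + 1) → w.getD 2 0 = zagLetter (t + 2) →
      Branches (Xa m n k ℓ) (proj m k ℓ (zig t)) (proj m k ℓ (zig (t + 1)))
        (proj m k ℓ (zig (t + 2))) (proj m k ℓ (step (zig (t + 2)) (zagLetter (t + 2)))) := by
    intro x τ w w' hw t1 t2 hx l0 l1 l2
    have hb := hw.branches (m := m) h t1 t2
    simp only [pos, l0, l1, l2, ← step_add t1 t2, ← hx, step_zig, add_assoc, one_add_one_eq_two] at hb
    exact hb
  obtain ⟨e, he | he | he | he⟩ : ∃ e, t = 4 * e ∨ t = 4 * e + 1 ∨ t = 4 * e + 2 ∨ t = 4 * e + 3 :=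
    ⟨t / 4, by omega⟩
  · refine key _ (2 * e, e, e) _ _ splits_even_up ?_ ?_ ?_ ?_ ?_ ?_
    · simp
    · simp only; omega
    · simp only [zig, Prod.mk_add_mk, Prod.mk.injEq]; omega
    · exact (if_pos (by omega)).symm
    · exact (if_neg (by omega)).symm
    · exact (if_pos (by omega)).symm
  · refine key _ (2 * e, e, e) _ _ splits_even_right ?_ ?_ ?_ ?_ ?_ ?_
    · simp
    · simp only; omega
    · simp only [zig, Prod.mk_add_mk, Prod.mk.injEq]; omega
    · exact (if_neg (by omega)).symm
    · exact (if_pos (by omega)).symm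
    · exact (if_neg (by omega)).symm
  · refine key _ (2 * e, e, e) _ _ splits_odd_up ?_ ?_ ?_ ?_ ?_ ?_
    · simp
    · simp only; omega
    · simp only [zig, Prod.mk_add_mk, Prod.mk.injEq]; omega
    · exact (if_pos (by omega)).symm
    · exact (if_neg (by omega)).symm
    · exact (if_pos (by omega)).symm
  -- Here the base point is `zig (-1)`, hence the translation by one more period.
  · refine key _ (2 * e + 2, e + 1, e + 1) _ _ splits_odd_right ?_ ?_ ?_ ?_ ?_ ?_
    · simp only; omega
    · simp only; omega
    · simp only [zig, Prod.mk_add_mk, Prod.mk.injEq]; omega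
    · exact (if_neg (by omega)).symm
    · exact (if_pos (by omega)).symm
    · exact (if_neg (by omega)).symm

theorem zig_of_row (h : Generic m n k ℓ) (h3 : ¬ HasTenCycleType3 m n k ℓ)
    (θ : Xa m n k ℓ ≃g Xa m n k ℓ)
    (e0 : θ (proj m k ℓ (0, -1, 0)) = proj m k ℓ (zig (-1)))
    (e1 : θ (proj m k ℓ (0, 0, 0)) = proj m k ℓ (zig 0))
    (e2 : θ (proj m k ℓ (0, 1, 0)) = proj m k ℓ (zig 1)) (t : ℕ) :
    θ (proj m k ℓ (0, t, 0)) = proj m k ℓ (zig t) := by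
  -- Three consecutive values are carried along: with the next vertex they form the four-vertex path
  -- to which branching is applied.
  suffices H : ∀ t : ℕ, θ (proj m k ℓ (0, (t : ℤ) - 1, 0)) = proj m k ℓ (zig ((t : ℤ) - 1)) ∧
      θ (proj m k ℓ (0, t, 0)) = proj m k ℓ (zig t) ∧
      θ (proj m k ℓ (0, (t : ℤ) + 1, 0)) = proj m k ℓ (zig ((t : ℤ) + 1)) from (H t).2.1
  intro t
  induction t with
  | zero => exact ⟨e0, e1, e2⟩
  | succ t ih =>
    obtain ⟨i0, i1, i2⟩ := ih
    push_cast
    rw [add_sub_cancel_right]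
    refine ⟨i1, i2, ?_⟩
    have hadj : (Xa m n k ℓ).Adj (proj m k ℓ (0, (t : ℤ) + 1, 0))
        (proj m k ℓ (0, (t : ℤ) + 1 + 1, 0)) := (adj_proj h.toLiftable _ _).2 ⟨1, by simp [step]⟩
    have himg := θ.map_adj_iff.2 hadj
    rw [i2] at himg
    obtain ⟨d, hd⟩ := (adj_proj h.toLiftable _ _).1 himg
    rcases eq_zigLetter_or ((t : ℤ) + 1) d with rfl | rfl | rfl
    · rw [hd, step_zig]
    · exfalso
      rw [step_zig_back, add_sub_cancel_right, ← i1] at hd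
      refine Apart.proj_ne h ?_ (θ.injective hd)
      refine ⟨by simp, fun _ => ⟨?_, fun h5 => ?_⟩⟩
      · simp only [sub_self, add_zero]; rw [abs_lt]; omega
      · have := h5.1
        simp only at this
        omega
    -- If the image left the zigzag, its path would branch; pulling back by `θ.symm` would make a
    -- path in row `0` branch.
    · exfalso
      have hb := (branches_zig h ((t : ℤ) - 1)).map θ.symm
      rw [sub_add_cancel, show (t : ℤ) - 1 + 2 = t + 1 by ring, ← hd, ← i0, ← i1, ← i2] at hb
      simp only [RelIso.symm_apply_apply] at hb
      refine not_branches_row h h3 ((t : ℤ) - 1) ?_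
      rw [sub_add_cancel, show (t : ℤ) - 1 + 2 = t + 1 by ring,
        show (t : ℤ) - 1 + 3 = t + 1 + 1 by ring]
      exact hb

/-! ### The reflection and its arithmetic consequences -/

/-- In a cubic graph, the images of a vertex and of two of its neighbours force the image of the
third. -/
theorem third_neighbour (h : Generic m n k ℓ) (θ : Xa m n k ℓ ≃g Xa m n k ℓ)
    {x x' : ℤ × ℤ × ℤ} (hx : θ (proj m k ℓ x) = proj m k ℓ x') (d₀ d₁ d₂ e₀ e₁ e₂ : Fin 3)
    (h1 : θ (proj m k ℓ (step x d₁)) = proj m k ℓ (step x' e₁))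
    (h2 : θ (proj m k ℓ (step x d₂)) = proj m k ℓ (step x' e₂))
    (a1 : Apart (step x d₀) (step x d₁)) (a2 : Apart (step x d₀) (step x d₂))
    (he : ∀ e, e = e₀ ∨ e = e₁ ∨ e = e₂) :
    θ (proj m k ℓ (step x d₀)) = proj m k ℓ (step x' e₀) := by
  have himg := θ.map_adj_iff.2 ((adj_proj h.toLiftable x _).2 ⟨d₀, rfl⟩)
  rw [hx] at himg
  obtain ⟨e, hd⟩ := (adj_proj h.toLiftable _ _).1 himg
  rcases he e with rfl | rfl | rfl
  · exact hd
  · exact absurd (θ.injective (hd.trans h1.symm)) (a1.proj_ne h)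
  · exact absurd (θ.injective (hd.trans h2.symm)) (a2.proj_ne h)

/-- The automorphism that interchanges `u_{1,0}` and `u_{0,1}` interchanges row `0` with the
zigzag, and it sends `u_{0,2k}` to `u_{1,2-k}`. -/
theorem reflection_values (h : Generic m n k ℓ) (h3 : ¬ HasTenCycleType3 m n k ℓ)
    (θ : Xa m n k ℓ ≃g Xa m n k ℓ) (h00 : θ (0, 0) = (0, 0)) (h10 : θ (1, 0) = (0, 1))
    (h01 : θ (0, 1) = (1, 0)) :
    (∀ t : ℕ, θ (proj m k ℓ (0, t, 0)) = proj m k ℓ (zig t)) ∧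
      (∀ t : ℕ, θ (proj m k ℓ (zig t)) = proj m k ℓ (0, t, 0)) ∧
      θ (proj m k ℓ (0, 0, 2)) = proj m k ℓ (1, 2, -1) := by
  have hm := h.four_le_m
  have p0 : proj m k ℓ (0, 0, 0) = (0, 0) := by simp [proj]
  have p1 : proj m k ℓ (0, 1, 0) = (0, 1) := by simp [proj]
  have p2 : proj m k ℓ (1, 0, 0) = (1, 0) := by
    have : (1 : ℤ) / (m : ℤ) = 0 := Int.ediv_eq_zero_of_lt (by norm_num) (by omega)
    simp [proj, this]
  rw [← p0] at h00
  rw [← p1, ← p2] at h10 h01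
  have hneg : θ (proj m k ℓ (0, -1, 0)) = proj m k ℓ (0, -1, 0) :=
    third_neighbour h θ h00 2 0 1 2 1 0 h10 h01 (by decide) (by decide) (by decide)
  have row := zig_of_row h h3 θ hneg h00 h01
  -- The hypotheses on `θ` are symmetric under inversion, so `zig_of_row` also applies to `θ.symm`;
  -- `θ` need not be an involution.
  have col : ∀ t : ℕ, θ (proj m k ℓ (zig t)) = proj m k ℓ (0, t, 0) := by
    intro t
    rw [← zig_of_row h h3 θ.symm (θ.symm_apply_eq.2 hneg.symm) (θ.symm_apply_eq.2 h00.symm)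
      (θ.symm_apply_eq.2 h10.symm) t]
    exact θ.apply_symm_apply _
  refine ⟨row, col, ?_⟩
  have q2 : θ (proj m k ℓ (1, 0, 2)) = proj m k ℓ (1, 2, 0) :=
    third_neighbour h θ (x := (1, 0, 1)) (x' := (0, 2, 0)) (col 2) 1 2 0 0 2 1 (col 1) (col 3)
      (by decide) (by decide) (by decide)
  have q4 : θ (proj m k ℓ (1, 4, 0)) = proj m k ℓ (2, 2, 1) :=
    third_neighbour h θ (x := (0, 4, 0)) (x' := (2, 1, 1)) (row 4) 0 1 2 1 0 2 (row 5) (row 3)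
      (by decide) (by decide) (by decide)
  -- Since `3 k = 4 - k`, the vertex `u_{1,3k}` is adjacent to both `u_{1,2k}` and `u_{1,4}`. Their
  -- images have a single common neighbour.
  have q3 : θ (proj m k ℓ (1, 0, 3)) = proj m k ℓ (1, 2, 1) := by
    have s1 := θ.map_adj_iff.2 ((adj_proj h.toLiftable (1, 0, 2) (proj m k ℓ (1, 0, 3))).2 ⟨1, rfl⟩)
    have s2 := θ.map_adj_iff.2 ((adj_proj h.toLiftable (1, 4, 0) (proj m k ℓ (1, 0, 3))).2
      ⟨2, proj_eq_of h rfl rfl rfl⟩)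
    rw [q2] at s1
    rw [q4] at s2
    obtain ⟨d, hd⟩ := (adj_proj h.toLiftable _ _).1 s1
    obtain ⟨e, he⟩ := (adj_proj h.toLiftable _ _).1 s2
    have hc : ∀ d e : Fin 3, Apart (step (1, 2, 0) d) (step (2, 2, 1) e) ∨ d = 1 := by decide
    rcases hc d e with ha | rfl
    · exact absurd (hd.symm.trans he) (ha.proj_ne h)
    · exact hd
  exact third_neighbour h θ (x := (1, 0, 2)) (x' := (1, 2, 0)) q2 0 2 1 2 0 1 (col 2) q3
    (by decide) (by decide) (by decide)

/-- Number-theoretic consequences of the existence of the reflection. -/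
theorem parameters_of_reflection (h : Generic m n k ℓ) (h3 : ¬ HasTenCycleType3 m n k ℓ)
    (θ : Xa m n k ℓ ≃g Xa m n k ℓ) (h00 : θ (0, 0) = (0, 0)) (h10 : θ (1, 0) = (0, 1))
    (h01 : θ (0, 1) = (1, 0)) {m₀ t : ℕ} (hm₀ : m = 2 * m₀) (ht : n = 8 * t)
    (two_k : 2 * k = ((2 + 4 * t : ℕ) : ZMod n)) :
    ∃ n₀ y : ℕ, 1 ≤ n₀ ∧ n = 4 * n₀ * m ∧ (2 * n₀ : ℤ) ∣ (y : ℤ) ^ 2 - 1 ∧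
      (m₀ : ZMod n) * (k + 1) + ℓ = ((2 * m * y : ℕ) : ZMod n) := by
  obtain ⟨row, col, hr⟩ := reflection_values h h3 θ h00 h10 h01
  have hm := h.four_le_m
  have hn := h.large_n
  have : NeZero n := ⟨by omega⟩
  have h4t : ((8 * t : ℕ) : ZMod n) = 0 := by rw [← ht]; simp
  -- Two values of `θ` at `u_{0,2k} = u_{0,2+4t}`: from row `0` and from the local computation.
  have hz : proj m k ℓ (zig ((2 + 4 * t : ℕ) : ℤ)) = proj m k ℓ (1, 2, -1) := by
    rw [← row, ← hr]
    congr 1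
    simp only [proj]
    push_cast at two_k ⊢
    simp [← two_k]
  have hzig : zig ((2 + 4 * t : ℕ) : ℤ) = (1 + 2 * (t : ℤ), (t : ℤ), (t : ℤ) + 1) := by
    simp only [zig, Prod.mk.injEq]; push_cast; omega
  rw [hzig] at hz
  have hrow := (row_eq_iff _ _).1 (congrArg Prod.fst hz)
  obtain ⟨n₀, hn₀⟩ : m ∣ 2 * t := by
    have : (m : ℤ) ∣ ((2 * t : ℕ) : ℤ) := by push_cast; simpa using hrow
    exact_mod_cast this
  have htn : t = m₀ * n₀ := by
    have : 2 * t = 2 * (m₀ * n₀) := by rw [hn₀, hm₀]; ring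
    omega
  have hnm : n = 4 * n₀ * m := by rw [ht, htn, hm₀]; ring
  have hn₀pos : 1 ≤ n₀ := by
    rcases Nat.eq_zero_or_pos n₀ with rfl | hp
    · simp at hnm; omega
    · exact hp
  set s : ZMod n := (m₀ : ZMod n) * (k + 1) + ℓ with hs
  -- once around the rows along the zigzag
  have hturn : ∀ r : ℕ, proj m k ℓ (zig ((2 * m * r : ℕ) : ℤ)) = (0, r * s) := by
    intro r
    have e1 : zig ((2 * m * r : ℕ) : ℤ) = ((m * r : ℤ), (m₀ * r : ℤ), (m₀ * r : ℤ)) := by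
      simp only [zig, Prod.mk.injEq, hm₀]
      push_cast
      have : (2 * (2 * (m₀ : ℤ)) * r) = 4 * (m₀ * r) := by ring
      have : (2 * (m₀ : ℤ) * r) = 2 * (m₀ * r) := by ring
      omega
    rw [e1]
    have e2 : ((m : ℤ) * r) / (m : ℤ) = r := Int.mul_ediv_cancel_left _ (by omega)
    refine Prod.ext (by simp [proj]) ?_
    simp only [proj, e2, hs]
    push_cast
    ring
  have hcol := congrArg Prod.snd hz
  have hd1 : (1 + 2 * (t : ℤ)) / (m : ℤ) = n₀ := by
    have : (1 + 2 * (t : ℤ)) = 1 + m * n₀ := by exact_mod_cast congrArg (1 + ·) hn₀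
    rw [this, Int.add_mul_ediv_left _ _ (by omega), Int.ediv_eq_zero_of_lt (by norm_num) (by omega)]
    simp
  have hd2 : (1 : ℤ) / (m : ℤ) = 0 := Int.ediv_eq_zero_of_lt (by norm_num) (by omega)
  simp only [proj, hd1, hd2] at hcol
  -- The column comparison reads `n₀ s = 2 - 2k = -4t`, and `-4t = 4t = 2 m n₀` modulo `n = 8t`.
  have hns : (n₀ : ZMod n) * s = ((2 * m * n₀ : ℕ) : ZMod n) := by
    have e1 : ((2 * m * n₀ : ℕ) : ZMod n) = ((4 * t : ℕ) : ZMod n) := by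
      congr 1; rw [htn, hm₀]; ring
    rw [e1]
    have e3 : (t : ZMod n) = m₀ * n₀ := by rw [htn]; push_cast; ring
    push_cast at hcol two_k h4t ⊢
    rw [hs]
    linear_combination hcol - two_k - (k + 1) * e3 - h4t
  -- Cancelling `n₀` from the modulus `n = n₀ (4 m)` gives `s ≡ 2m` modulo `4m`.
  obtain ⟨y, hy⟩ : ∃ y, s.val = 2 * m * y := by
    have hv : ((n₀ * s.val : ℕ) : ZMod n) = ((2 * m * n₀ : ℕ) : ZMod n) := by
      rw [← hns]; push_cast; rw [ZMod.natCast_zmod_val]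
    have hmod := (ZMod.natCast_eq_natCast_iff _ _ _).1 hv
    have hmod2 : n₀ * s.val ≡ n₀ * (2 * m) [MOD n₀ * (4 * m)] := by
      have e : n₀ * (4 * m) = n := by rw [hnm]; ring
      rw [e, mul_comm n₀ (2 * m)]; exact hmod
    have hmod3 := Nat.ModEq.mul_left_cancel' (by omega) hmod2
    have hmod4 : s.val ≡ 2 * m [MOD 2 * m] := hmod3.of_dvd ⟨2, by ring⟩
    have : 2 * m ∣ s.val := (Nat.modEq_zero_iff_dvd.1 (hmod4.trans (by simp [Nat.ModEq])))
    exact this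
  have hsy : s = ((2 * m * y : ℕ) : ZMod n) := by rw [← hy, ZMod.natCast_zmod_val]
  refine ⟨n₀, y, hn₀pos, hnm, ?_, hsy⟩
  -- The vertex `u_{0,s}` is both `zig (2m)`, with image `u_{0,2m}`, and the row vertex `u_{0,2my}`,
  -- with image `zig (2my) = u_{0,ys}`. Hence `y s = 2m`.
  have c1 := col (2 * m * 1)
  have c2 := row (2 * m * y)
  rw [hturn] at c1 c2
  have e1 : proj m k ℓ (0, ((2 * m * y : ℕ) : ℤ), 0) = (0, ((1 : ℕ) : ZMod n) * s) := by
    rw [hsy]; simp [proj]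
  rw [e1, c1] at c2
  have c3 := congrArg Prod.snd c2
  rw [hsy] at c3
  simp only [proj, Int.zero_ediv] at c3
  have c4 : (((2 * m) * (y ^ 2 - 1 : ℤ) : ℤ) : ZMod n) = 0 := by
    push_cast at c3 ⊢
    linear_combination -c3
  have c5 := (ZMod.intCast_zmod_eq_zero_iff_dvd _ _).1 c4
  have e2 : (n : ℤ) = (2 * m) * (2 * n₀) := by rw [hnm]; push_cast; ring
  rw [e2] at c5
  exact Int.dvd_of_mul_dvd_mul_left (by omega) c5

/-! ### Isomorphisms realising changes of parameters -/

theorem val_add_mod_two (hn : Even n) (hpos : 0 < n) (i j : ZMod n) :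
    (i + j).val % 2 = (i.val + j.val) % 2 := by
  have : NeZero n := ⟨hpos.ne'⟩
  rw [ZMod.val_add, Nat.mod_mod_of_dvd _ hn.two_dvd]

theorem val_neg_mod_two (hn : Even n) (hpos : 0 < n) (j : ZMod n) :
    (-j).val % 2 = j.val % 2 := by
  have h1 := val_add_mod_two hn hpos (-j) j
  rw [neg_add_cancel, ZMod.val_zero] at h1
  omega

theorem xa_adj_map {k' ℓ' : ZMod n} {f : Vertex m n → Vertex m n} (hf : Function.Injective f)
    (h1 : ∀ x y, LinkTo ℓ x y → LinkTo ℓ' (f x) (f y))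
    (h2 : ∀ x y, NonLinkTo (fun i => altEntry k i) (fun i => -altEntry k i) x y →
      NonLinkTo (fun i => altEntry k' i) (fun i => -altEntry k' i) (f x) (f y))
    {x y : Vertex m n} (h : (Xa m n k ℓ).Adj x y) : (Xa m n k' ℓ').Adj (f x) (f y) := by
  unfold Xa XaSignature at *
  rw [SimpleGraph.fromRel_adj] at *
  exact ⟨fun he => h.1 (hf he), h.2.imp (Or.imp (h1 _ _) (h2 _ _)) (Or.imp (h1 _ _) (h2 _ _))⟩

/-- An involution of the vertices that maps edges to edges in both directions. -/
def isoOfInvolutive {V : Type*} {G H : SimpleGraph V} (f : V → V) (hf : Function.Involutive f)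
    (h1 : ∀ {x y}, G.Adj x y → H.Adj (f x) (f y)) (h2 : ∀ {x y}, H.Adj x y → G.Adj (f x) (f y)) :
    G ≃g H where
  toEquiv := hf.toPerm
  map_rel_iff' := by
    intro x y
    refine ⟨fun h => ?_, h1⟩
    have := h2 h
    simpa [hf x, hf y] using this

/-- The reflection `u_{i,j} ↦ u_{i,-j}`. -/
def flip (x : Vertex m n) : Vertex m n := (x.1, -x.2)

theorem flip_involutive : Function.Involutive (flip : Vertex m n → Vertex m n) := by
  intro x; simp [flip]

theorem linkTo_flip (hn : Even n) (hpos : 0 < n) {x y : Vertex m n} (h : LinkTo ℓ x y) :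
    LinkTo (-ℓ) (flip x) (flip y) := by
  refine ⟨(val_neg_mod_two hn hpos _).trans h.1, ?_⟩
  rcases h.2 with ⟨h1, rfl⟩ | ⟨h1, rfl⟩
  · exact Or.inl ⟨h1, rfl⟩
  · exact Or.inr ⟨h1, by simp [flip, add_comm]⟩

theorem adj_flip (hn : Even n) (hpos : 0 < n) {x y : Vertex m n} (h : (Xa m n k ℓ).Adj x y) :
    (Xa m n k (-ℓ)).Adj (flip x) (flip y) := by
  refine xa_adj_map flip_involutive.injective (fun x y => linkTo_flip hn hpos) ?_ h
  rintro x y ⟨hp, rfl | rfl⟩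
  · exact ⟨(val_neg_mod_two hn hpos _).trans hp, Or.inr (by simp [flip, add_comm])⟩
  · exact ⟨(val_neg_mod_two hn hpos _).trans hp, Or.inl (by simp [flip, add_comm])⟩

/-- The reflection as an isomorphism that replaces `ℓ` by `-ℓ`. -/
def flipIso (hn : Even n) (hpos : 0 < n) (k ℓ : ZMod n) : Xa m n k ℓ ≃g Xa m n k (-ℓ) :=
  isoOfInvolutive flip flip_involutive (adj_flip hn hpos)
    (fun h => by simpa using adj_flip hn hpos h)

theorem isLink_flip (hn : Even n) (hpos : 0 < n) {x y : Vertex m n} :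
    IsLink (-ℓ) (flip x) (flip y) ↔ IsLink ℓ x y := by
  constructor
  · intro h
    have := h.imp (linkTo_flip hn hpos) (linkTo_flip hn hpos)
    rwa [neg_neg, flip_involutive x, flip_involutive y] at this
  · exact fun h => h.imp (linkTo_flip hn hpos) (linkTo_flip hn hpos)

theorem HasTenCycleWithCode.flip (hn : Even n) (hpos : 0 < n) {s : Fin 10 → Fin 2}
    (h : HasTenCycleWithCode m n k ℓ s) : HasTenCycleWithCode m n k (-ℓ) s := by
  obtain ⟨v, h1, h2, h3⟩ := h
  refine ⟨fun j => AltCycle.flip (v j), flip_involutive.injective.comp h1,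
    fun j => adj_flip hn hpos (h2 j), fun j => ?_⟩
  rw [isLink_flip hn hpos]
  exact h3 j

theorem half_add_half (hn : Even n) : ((n / 2 : ℕ) : ZMod n) + ((n / 2 : ℕ) : ZMod n) = 0 := by
  rw [← Nat.cast_add, show n / 2 + n / 2 = n by obtain ⟨c, rfl⟩ := hn; omega, ZMod.natCast_self]

/-- Translation of `u_{i,j}` by `n / 2` for two of every four consecutive links. -/
def halfShift (x : Vertex m n) : Vertex m n :=
  (x.1, x.2 + (((x.1.val + x.2.val % 2) / 2 : ℕ) : ZMod n) * ((n / 2 : ℕ) : ZMod n))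

theorem val_halfShift (hn : 4 ∣ n) (hpos : 0 < n) (x : Vertex m n) :
    (halfShift x).2.val % 2 = x.2.val % 2 := by
  obtain ⟨c, hc⟩ := hn
  have hn : Even n := ⟨2 * c, by omega⟩
  have hc' : n / 2 = 2 * c := by omega
  have : NeZero n := ⟨hpos.ne'⟩
  simp only [halfShift]
  rw [val_add_mod_two hn hpos, hc', ← Nat.cast_mul, ZMod.val_natCast, Nat.add_mod,
    Nat.mod_mod_of_dvd _ hn.two_dvd, mul_left_comm]
  simp

theorem halfShift_involutive (hn : 4 ∣ n) (hpos : 0 < n) :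
    Function.Involutive (halfShift : Vertex m n → Vertex m n) := by
  intro x
  have h1 := val_halfShift hn hpos x
  have h2 := half_add_half (n := n) ⟨n / 2, by omega⟩
  refine Prod.ext rfl ?_
  change (halfShift x).2 + ((((x.1).val + (halfShift x).2.val % 2) / 2 : ℕ) : ZMod n) *
    ((n / 2 : ℕ) : ZMod n) = x.2
  rw [h1]
  simp only [halfShift]
  linear_combination (((x.1.val + x.2.val % 2) / 2 : ℕ) : ZMod n) * h2

/-- The multiple of `n / 2` in `halfShift` agrees at both ends of every link `u_{i,j} u_{i+1,j}`. In
even rows it is constant; in odd rows it differs by one between the two parities of `j`, which turns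
`±k` into `±(k + n / 2)`. On the wrapping links it drops from `m / 2` to 0, hence the relation
between `ℓ'` and `ℓ`. -/
theorem adj_halfShift (hn : 4 ∣ n) (hpos : 0 < n) (hk : Odd k.val) {ℓ' : ZMod n}
    (hm : Even m)
    (hℓ' : ((m / 2 : ℕ) : ZMod n) * ((n / 2 : ℕ) : ZMod n) + ℓ' = ℓ)
    {x y : Vertex m n} (h : (Xa m n k ℓ).Adj x y) :
    (Xa m n (k + ((n / 2 : ℕ) : ZMod n)) ℓ').Adj (halfShift x) (halfShift y) := by
  have hne : Even n := ⟨n / 2, by omega⟩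
  have h2 := half_add_half hne
  refine xa_adj_map (halfShift_involutive hn hpos).injective ?_ ?_ h
  · rintro ⟨i, j⟩ y ⟨hp, hy⟩
    have hp' : j.val % 2 = i.val % 2 := hp
    refine ⟨(val_halfShift hn hpos _).trans hp, ?_⟩
    rcases hy with ⟨h1, rfl⟩ | ⟨h1, rfl⟩
    · refine Or.inl ⟨h1, Prod.ext rfl ?_⟩
      simp only at h1
      have hv : (i + 1 : ZMod m).val = i.val + 1 := by
        have : Fact (1 < m) := ⟨by omega⟩
        rw [ZMod.val_add_of_lt] <;> rw [ZMod.val_one]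
        exact h1
      simp only [halfShift, hv]
      congr 3
      omega
    · refine Or.inr ⟨h1, Prod.ext rfl ?_⟩
      simp only at h1
      have e1 : (i.val + j.val % 2) / 2 = m / 2 := by
        obtain ⟨c, rfl⟩ := hm; omega
      have e2 : ((0 : ZMod m).val + (j + ℓ).val % 2) / 2 = 0 := by
        rw [ZMod.val_zero]; omega
      simp only [halfShift, e1, e2]
      rw [← hℓ']
      push_cast
      ring
  · rintro ⟨i, j⟩ y ⟨hp, hy⟩
    have hp' : j.val % 2 = i.val % 2 := hp
    refine ⟨(val_halfShift hn hpos _).trans hp, ?_⟩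
    rcases Nat.mod_two_eq_zero_or_one i.val with hi | hi
    · have e0 : ∀ a : ℕ, (i.val + a % 2) / 2 = i.val / 2 := fun a => by omega
      refine hy.imp ?_ ?_ <;> rintro rfl <;> refine Prod.ext rfl ?_ <;>
        simp only [halfShift, altEntry, hi, if_true, e0] <;> ring
    · have e0 : (i.val + j.val % 2) / 2 = i.val / 2 + 1 := by omega
      have o1 := val_add_mod_two hne hpos j k
      have o2 := val_add_mod_two hne hpos j (-k)
      have o3 := val_neg_mod_two hne hpos k
      have o4 := Nat.odd_iff.1 hk
      have e1 : (i.val + (j + k).val % 2) / 2 = i.val / 2 := by omega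
      have e2 : (i.val + (j + -k).val % 2) / 2 = i.val / 2 := by omega
      refine hy.imp ?_ ?_ <;> rintro rfl <;> refine Prod.ext rfl ?_
      · simp only [halfShift, altEntry, hi, one_ne_zero, if_false, e0, e1]
        push_cast
        linear_combination -h2
      · simp only [halfShift, altEntry, hi, one_ne_zero, if_false, e0, e2]
        push_cast
        ring

theorem half_mul_half_of_dvd (hn : Even n) (hm : 4 ∣ m) :
    ((m / 2 : ℕ) : ZMod n) * ((n / 2 : ℕ) : ZMod n) = 0 := by
  obtain ⟨c, rfl⟩ := hm
  rw [show 4 * c / 2 = 2 * c by omega]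
  push_cast
  linear_combination (c : ZMod n) * half_add_half hn

theorem half_mul_half_of_not_dvd (hn : Even n) (hm : Even m) (hm4 : ¬ 4 ∣ m) :
    ((m / 2 : ℕ) : ZMod n) * ((n / 2 : ℕ) : ZMod n) = ((n / 2 : ℕ) : ZMod n) := by
  obtain ⟨c, hc⟩ : ∃ c, m / 2 = 2 * c + 1 := ⟨m / 4, by obtain ⟨d, rfl⟩ := hm; omega⟩
  rw [hc]
  push_cast
  linear_combination (c : ZMod n) * half_add_half hn

/-- Replacing `k` by `k + n / 2` is a change of parameters that is realised by an isomorphism and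
leaves the displacement `(m / 2) (k + 1) + ℓ` of a full turn of the zigzag unchanged. -/
theorem exists_shift (hn : 4 ∣ n) (hpos : 0 < n) (hm : Even m) (hk : Odd k.val) :
    ∃ ℓ' : ZMod n, ParamStep m n (k, ℓ) (k + ((n / 2 : ℕ) : ZMod n), ℓ') ∧
      Nonempty (Xa m n k ℓ ≃g Xa m n (k + ((n / 2 : ℕ) : ZMod n)) ℓ') ∧
      ((m / 2 : ℕ) : ZMod n) * (k + ((n / 2 : ℕ) : ZMod n) + 1) + ℓ' =
        ((m / 2 : ℕ) : ZMod n) * (k + 1) + ℓ := by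
  have hne : Even n := ⟨n / 2, by omega⟩
  have h2 := half_add_half hne
  have hev : ((n / 2 : ℕ) : ZMod n).val % 2 = 0 := by
    rw [ZMod.val_natCast, Nat.mod_mod_of_dvd _ hne.two_dvd]; omega
  have hk' : Odd (k + ((n / 2 : ℕ) : ZMod n)).val := by
    rw [Nat.odd_iff] at hk ⊢
    rw [val_add_mod_two hne hpos]; omega
  have hkk : k + ((n / 2 : ℕ) : ZMod n) + ((n / 2 : ℕ) : ZMod n) = k := by
    rw [add_assoc, h2, add_zero]
  have key : ∀ ℓ' : ZMod n,
      ((m / 2 : ℕ) : ZMod n) * ((n / 2 : ℕ) : ZMod n) + ℓ' = ℓ →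
      Nonempty (Xa m n k ℓ ≃g Xa m n (k + ((n / 2 : ℕ) : ZMod n)) ℓ') := by
    intro ℓ' hℓ'
    refine ⟨isoOfInvolutive halfShift (halfShift_involutive hn hpos)
      (adj_halfShift hn hpos hk hm hℓ') fun {x y} h => ?_⟩
    have := adj_halfShift (ℓ' := ℓ) hn hpos hk' hm ?_ h
    · rwa [hkk] at this
    · rw [← hℓ']
      linear_combination ((m / 2 : ℕ) : ZMod n) * h2
  by_cases hm4 : 4 ∣ m
  · have h0 := half_mul_half_of_dvd hne hm4
    refine ⟨ℓ, ParamStep.shift_k k ℓ hn hm4, key ℓ (by rw [h0, zero_add]), ?_⟩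
    linear_combination h0
  · have h0 := half_mul_half_of_not_dvd hne hm hm4
    refine ⟨ℓ + ((n / 2 : ℕ) : ZMod n), ParamStep.shift_k_ℓ k ℓ hn hm4, key _ ?_, ?_⟩
    · rw [h0]; linear_combination h2
    · linear_combination h0 + h2

/-! ### Solving for `k`, the case `n = 16`, and the normal form -/

/-- The solutions of `4 k = 4` with `2 k ≠ 2` and `k` odd. -/
theorem eq_of_four_mul_eq_four (hpos : 0 < n) (hk : Odd k.val) (h4 : 4 * k = 4) (h2 : 2 * k ≠ 2) :
    ∃ t, n = 8 * t ∧ (k = ((1 + 2 * t : ℕ) : ZMod n) ∨ k = ((1 + 6 * t : ℕ) : ZMod n)) := by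
  have : NeZero n := ⟨hpos.ne'⟩
  obtain ⟨e, he⟩ := hk
  have hlt := ZMod.val_lt k
  have hke : k = ((2 * e + 1 : ℕ) : ZMod n) := by rw [← he, ZMod.natCast_zmod_val]
  obtain ⟨c, hc⟩ : n ∣ 8 * e := by
    rw [← ZMod.natCast_eq_zero_iff]
    rw [hke] at h4
    push_cast at h4 ⊢
    linear_combination h4
  have hodd : ∀ c', c ≠ 2 * c' := by
    rintro c' rfl
    apply h2
    have h5 : ((4 * e : ℕ) : ZMod n) = 0 := by
      rw [ZMod.natCast_eq_zero_iff]
      exact ⟨c', by linarith [mul_left_comm n 2 c']⟩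
    rw [hke]
    push_cast at h5 ⊢
    linear_combination h5
  have hc4 : c < 4 := by
    by_contra hcon
    have : n * 4 ≤ n * c := Nat.mul_le_mul_left _ (by omega)
    omega
  have := hodd 0
  have := hodd 1
  obtain rfl | rfl : c = 1 ∨ c = 3 := by omega
  · exact ⟨e, by omega, Or.inl (by rw [hke, add_comm])⟩
  · exact ⟨n / 8, by omega, Or.inr (by rw [hke]; congr 1; omega)⟩

/-- The word of type 2 ends at `(0, 6, 2)`, and `6 + 2 k = 16` or `32` for `k = 5` or `13`. This
removes the one value of `n` below the bound 24. -/
theorem hasTenCycleType2_of_eq_sixteen {k ℓ : ZMod 16} (h : Liftable m 16 k ℓ)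
    (hk : k = 5 ∨ k = 13) : HasTenCycleType2 m 16 k ℓ := by
  have hm := h.four_le_m
  set w : List (Fin 3) := [1, 1, 1, 1, 1, 1, 0, 1, 1, 0] with hw
  have hp : pos (0, 0, 0) w 10 = (0, 6, 2) := by rw [hw]; decide
  have hclose : proj m k ℓ (0, 0, 0) = proj m k ℓ (pos (0, 0, 0) w 10) := by
    rw [hp]
    refine Prod.ext (by simp [proj]) ?_
    simp only [proj, add_left_inj]
    rcases hk with rfl | rfl <;> decide
  have hnext : ∀ j : Fin 10, proj m k ℓ (pos (0, 0, 0) w (j + 1 : Fin 10)) =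
      proj m k ℓ (step (pos (0, 0, 0) w j) (w.getD j 0)) := by
    intro j
    by_cases hj : j = 9
    · subst hj; exact hclose
    · have : ((j + 1 : Fin 10) : ℕ) = (j : ℕ) + 1 := by
        rw [Fin.val_add_one_of_lt]
        exact lt_of_le_of_ne (Fin.le_last j) hj
      rw [this]; rfl
  refine ⟨fun j => proj m k ℓ (pos (0, 0, 0) w j), ?_, fun j => ?_, fun j => ?_⟩
  · intro i j hij
    have c1 : ∀ i j : Fin 10, |(pos (0, 0, 0) w i).1 - (pos (0, 0, 0) w j).1| < 4 := by
      rw [hw]; decide +kernel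
    obtain ⟨h1, h2⟩ := proj_eq _ _ hij (by have := c1 i j; omega)
    have c2 : ∀ i j : Fin 10, (pos (0, 0, 0) w i).1 = (pos (0, 0, 0) w j).1 →
        (((pos (0, 0, 0) w i).2.1 - (pos (0, 0, 0) w j).2.1 : ℤ) : ZMod 16) +
          (((pos (0, 0, 0) w i).2.2 - (pos (0, 0, 0) w j).2.2 : ℤ) : ZMod 16) * k = 0 →
        i = j := by
      rcases hk with rfl | rfl <;> rw [hw] <;> decide +kernel
    exact c2 i j h1 h2
  · exact (adj_proj h _ _).2 ⟨_, hnext j⟩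
  · simp only [hnext, isLink_step h]
    revert j; rw [hw]; decide

/-- The final parametrisation. -/
theorem exists_parameters {n₀ m₀ y : ℕ} {ℓ' : ZMod n} (hn₀ : 1 ≤ n₀) (hm : m = 2 * m₀)
    (hn : n = 4 * n₀ * m) (hy : (2 * n₀ : ℤ) ∣ (y : ℤ) ^ 2 - 1)
    (hs : (m₀ : ZMod n) * (((n₀ * m + 1 : ℕ) : ZMod n) + 1) + ℓ' = ((2 * m * y : ℕ) : ZMod n)) :
    ∃ ℓ₀ : ℕ, ℓ₀ < 4 * n₀ ∧
      (8 * n₀ : ℤ) ∣ ((m₀ : ℤ) * n₀ + ℓ₀ - 1) * ((m₀ : ℤ) * n₀ + ℓ₀ + 3) ∧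
      ℓ' = ((ℓ₀ * m : ℕ) : ZMod n) := by
  have hpos : (0 : ℤ) < 4 * n₀ := by omega
  -- Dividing `m₀ (n₀ m + 2) + ℓ₀ m = 2 m y` by `m = 2 m₀` gives `ℓ₀ = 2y - 1 - m₀ n₀`, to be
  -- reduced modulo `4 n₀`.
  set c : ℤ := 2 * y - 1 - m₀ * n₀ with hc
  have h1 := Int.emod_nonneg c hpos.ne'
  have h2 := Int.emod_lt_of_pos c hpos
  have h3 := Int.emod_add_mul_ediv c (4 * n₀)
  obtain ⟨ℓ₀, hℓ₀⟩ := Int.eq_ofNat_of_zero_le h1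
  set z := c / (4 * n₀)
  rw [hℓ₀] at h2 h3
  refine ⟨ℓ₀, by omega, ?_, ?_⟩
  · obtain ⟨q, hq⟩ := hy
    -- The product equals `(2y - 4 n₀ z)² - 4`; substituting `y² - 1 = 2 n₀ q` and dividing by `8
    -- n₀` yields this quotient.
    refine ⟨q - 2 * y * z + 2 * n₀ * z ^ 2, ?_⟩
    have e : (ℓ₀ : ℤ) = 2 * y - 1 - m₀ * n₀ - 4 * n₀ * z := by linarith
    rw [e]
    linear_combination 4 * hq
  · have h0 : ((4 * n₀ * m : ℕ) : ZMod n) = 0 := by rw [← hn]; exact ZMod.natCast_self n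
    have e : (ℓ₀ : ZMod n) = 2 * y - 1 - m₀ * n₀ - 4 * n₀ * z := by
      have : (ℓ₀ : ℤ) = 2 * y - 1 - m₀ * n₀ - 4 * n₀ * z := by linarith
      exact_mod_cast congrArg (Int.cast : ℤ → ZMod n) this
    have hm' : (m : ZMod n) = 2 * m₀ := by rw [hm]; push_cast; ring
    push_cast at hs h0 ⊢
    rw [e]
    linear_combination hs + (z : ZMod n) * h0 + hm'

end AltCycle

/-! ### Assembly -/

theorem mainTheorem5 (m n : ℕ) (k ℓ : ZMod n)
    (hadm : AltCycle.Admissible m n k ℓ)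
    (hn : 14 ≤ n) (hk : 4 * k = 4)
    (h2 : ¬ AltCycle.HasTenCycleType2 m n k ℓ)
    (h3 : ¬ AltCycle.HasTenCycleType3 m n k ℓ)
    (hθ : ∃ θ : AltCycle.Xa m n k ℓ ≃g AltCycle.Xa m n k ℓ,
      θ (0, 0) = (0, 0) ∧
      ((θ (1, 0) = (0, 1) ∧ θ (0, 1) = (1, 0)) ∨
        (θ (1, 0) = (0, -1) ∧ θ (0, -1) = (1, 0)))) :
    ∃ m₀ n₀ ℓ₀ : ℕ, 2 ≤ m₀ ∧ 1 ≤ n₀ ∧ ℓ₀ < 4 * n₀ ∧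
      (8 * n₀ : ℤ) ∣ ((m₀ : ℤ) * n₀ + ℓ₀ - 1) * ((m₀ : ℤ) * n₀ + ℓ₀ + 3) ∧
      m = 2 * m₀ ∧ n = 4 * n₀ * m ∧
      ∃ k' ℓ' : ZMod n,
        AltCycle.ParamEquiv m n (k, ℓ) (k', ℓ') ∧
        Nonempty (AltCycle.Xa m n k ℓ ≃g AltCycle.Xa m n k' ℓ') ∧
        k' = ((n₀ * m + 1 : ℕ) : ZMod n) ∧ ℓ' = ((ℓ₀ * m : ℕ) : ZMod n) := by
  open AltCycle in
  have hpos : 0 < n := by omega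
  obtain ⟨m₀, hm₀⟩ : ∃ m₀, m = 2 * m₀ := hadm.even_m.two_dvd
  have h3m := hadm.three_le_m
  have hlift : Liftable m n k ℓ :=
    ⟨by omega, hadm.even_m, hn, hadm.even_n, hadm.odd_k, hadm.even_ℓ⟩
  obtain ⟨t, ht, hkt⟩ := eq_of_four_mul_eq_four hpos hadm.odd_k hk hadm.two_k_ne.1
  have ht3 : 3 ≤ t := by
    by_contra hcon
    obtain rfl : t = 2 := by omega
    subst ht
    refine h2 (hasTenCycleType2_of_eq_sixteen hlift (hkt.imp ?_ ?_)) <;>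
      · rintro rfl; rfl
  have h8 : ((8 * t : ℕ) : ZMod n) = 0 := by rw [← ht]; exact ZMod.natCast_self n
  have h2k : 2 * k = ((2 + 4 * t : ℕ) : ZMod n) := by
    push_cast at h8 ⊢
    rcases hkt with rfl | rfl
    · push_cast; ring
    · push_cast; linear_combination h8
  have hm2 : m / 2 = m₀ := by omega
  obtain ⟨ℓ₁, hP₁, ⟨φ₁⟩, n₀, y, hn₀, hnm, hy, hs⟩ : ∃ ℓ₁ : ZMod n,
      ParamEquiv m n (k, ℓ) (k, ℓ₁) ∧ Nonempty (Xa m n k ℓ ≃g Xa m n k ℓ₁) ∧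
      ∃ n₀ y : ℕ, 1 ≤ n₀ ∧ n = 4 * n₀ * m ∧ (2 * n₀ : ℤ) ∣ (y : ℤ) ^ 2 - 1 ∧
        (m₀ : ZMod n) * (k + 1) + ℓ₁ = ((2 * m * y : ℕ) : ZMod n) := by
    obtain ⟨θ, h00, ⟨h10, h01⟩ | ⟨h10, h01⟩⟩ := hθ
    · exact ⟨ℓ, Relation.ReflTransGen.refl, ⟨RelIso.refl _⟩,
        parameters_of_reflection ⟨hlift, by omega, hk, hadm.two_k_ne.1⟩ h3 θ h00 h10 h01 hm₀ ht h2k⟩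
    -- Conjugating `θ` by the reflection turns `u_{0,-1}` into `u_{0,1}`, at the cost of replacing
    -- `ℓ` by `-ℓ`.
    · have hev := even_val_neg hadm.even_n hpos hadm.even_ℓ
      let φ := flipIso (m := m) hadm.even_n hpos k ℓ
      have hφ : ∀ i j, φ (i, j) = (i, -j) := fun _ _ => rfl
      have hψ : ∀ i j, φ.symm (i, j) = (i, -j) := fun _ _ => rfl
      refine ⟨-ℓ, Relation.ReflTransGen.single (ParamStep.neg_ℓ k ℓ), ⟨φ⟩,
        parameters_of_reflection ⟨⟨by omega, hadm.even_m, hn, hadm.even_n, hadm.odd_k, hev⟩,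
          by omega, hk, hadm.two_k_ne.1⟩ ?_ ((φ.symm.trans θ).trans φ) ?_ ?_ ?_ hm₀ ht h2k⟩
      · intro hc
        have := HasTenCycleWithCode.flip hadm.even_n hpos hc
        rw [neg_neg] at this
        exact h3 this
      · simp only [RelIso.trans_apply, hψ, neg_zero, h00, hφ]
      · simp only [RelIso.trans_apply, hψ, neg_zero, h10, hφ, neg_neg]
      · simp only [RelIso.trans_apply, hψ, h01, hφ, neg_zero]
  have h2t : n₀ * m = 2 * t := by
    have : 8 * t = 4 * (n₀ * m) := by rw [← ht, hnm]; ring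
    omega
  obtain ⟨k', ℓ', hP₂, ⟨φ₂⟩, hk', hs'⟩ : ∃ k' ℓ' : ZMod n, ParamEquiv m n (k, ℓ₁) (k', ℓ') ∧
      Nonempty (Xa m n k ℓ₁ ≃g Xa m n k' ℓ') ∧ k' = ((n₀ * m + 1 : ℕ) : ZMod n) ∧
      (m₀ : ZMod n) * (k' + 1) + ℓ' = (m₀ : ZMod n) * (k + 1) + ℓ₁ := by
    rcases hkt with hk1 | hk1
    · exact ⟨k, ℓ₁, Relation.ReflTransGen.refl, ⟨RelIso.refl _⟩, by rw [h2t, add_comm]; exact hk1, rfl⟩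
    -- Adding `n / 2 = 4t` moves `1 + 6t` to `1 + 10t = 1 + 2t`, without changing the turn
    -- displacement `s`.
    · obtain ⟨ℓ', a1, a2, a3⟩ := exists_shift (n := n) (m := m) ⟨2 * t, by omega⟩ hpos hadm.even_m
        hadm.odd_k
      rw [hm2] at a3
      refine ⟨_, ℓ', Relation.ReflTransGen.single a1, a2, ?_, a3⟩
      rw [h2t, hk1, show n / 2 = 4 * t by omega]
      push_cast at h8 ⊢
      linear_combination h8
  rw [hs, hk'] at hs'
  obtain ⟨ℓ₀, b1, b2, b3⟩ := exists_parameters hn₀ hm₀ hnm hy hs'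
  exact ⟨m₀, n₀, ℓ₀, by omega, hn₀, b1, b2, hm₀, hnm, k', ℓ', hP₁.trans hP₂, ⟨φ₁.trans φ₂⟩, hk', b3⟩
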